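/- Let $n_x,n_w,n_u,n_z,n_y\in\mathbb N_0$ and let a plant $$x(t+1)=Ax(t)+B_ww(t)+B_uu(t),\quad z(t)=C_zx(t)+D_{zw}w(t)+D_{zu}u(t),\quad y(t)=C_yx(t)+D_{yw}w(t)$$ and a controller $x_c(t+1)=A_cx_c(t)+B_cy(t)$, $u(t)=C_cx_c(t)+D_cy(t)$ be given by real matrices, with $x(t),x_c(t)\in\mathbb R^{n_x}$, $w(t)\in\mathbb R^{n_w}$, $u(t)\in\mathbb R^{n_u}$, $z(t)\in\mathbb R^{n_z}$, $y(t)\in\mathbb R^{n_y}$. The closed-loop matrices, with state $\chi=(x,x_c)$, are $$\mathcal A=\begin{pmatrix}A+B_uD_cC_y&B_uC_c\\B_cC_y&A_c\end{pmatrix},\quad \mathcal B=\begin{pmatrix}B_w+B_uD_cD_{yw}\\B_cD_{yw}\end{pmatrix},\quad \mathcal C=\begin{pmatrix}C_z+D_{zu}D_cC_y&D_{zu}C_c\end{pmatrix},\quad \mathcal D=D_{zw}+D_{zu}D_cD_{yw}.$$ Let $\Omega$ be a separable metric space with a Borel probability measure $\mathbb P$ that is atomless (every point has measure zero), let $\gamma\in\mathbb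 R$, and let $\mathbb P_{\rm nom}$ be a (possibly degenerate) normal distribution on $\mathbb R^{n_w}$ with zero mean and $\Sigma_{\rm nom}=\int vv^\top\,d\mathbb P_{\rm nom}(v)$. **Worst-case stochastic problem.** Maximize $$\limsup_{T\to\infty}\frac1T\sum_{t=0}^{T-1}\mathbb E\|z(t)\|^2$$ over $w,\hat w:\mathbb N_0\to L_2(\Omega,\mathbb R^{n_w})$, where $\chi(0)=0$, $\chi(t+1)=\mathcal A\chi(t)+\mathcal Bw(t)$, $z(t)=\mathcal C\chi(t)+\mathcal Dw(t)$, subject to $\mathbb E\|w(t)-\hat w(t)\|^2\le\gamma^2$ and $\mathbb P_{\hat w(t)}=\mathbb P_{\rm nom}$ for all $t\in\mathbb N_0$. In the correlated case there is no further constraint; in the independent case the random variables $w(0),w(1),\dots$ are moreover required to be independent with zero mean. **Moment relaxation.** Maximize $$\operatorname{tr}\left(\begin{pmatrix}\mathcal C&\mathcal D&0\end{pmatrix}\Sigma\begin{pmatrix}\mathcal C&\mathcal D&0\end{pmatrix}^\top\right)$$ over real symmetric matrices $$\Sigma=\begin{pmatrix}\Sigma_{\chi\chi}&\Sigma_{\chi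 w}&\Sigma_{\chi\hat w}\\\Sigma_{w\chi}&\Sigma_{ww}&\Sigma_{w\hat w}\\\Sigma_{\hat w\chi}&\Sigma_{\hat ww}&\Sigma_{\hat w\hat w}\end{pmatrix}\succeq0$$ subject to $\Sigma_{\chi\chi}=\begin{pmatrix}\mathcal A&\mathcal B&0\end{pmatrix}\Sigma\begin{pmatrix}\mathcal A&\mathcal B&0\end{pmatrix}^\top$, $\operatorname{tr}(\Sigma_{ww}-\Sigma_{w\hat w}-\Sigma_{\hat ww}+\Sigma_{\hat w\hat w})\le\gamma^2$ and $\Sigma_{\hat w\hat w}=\Sigma_{\rm nom}$. In the correlated case ($\Sigma\in\mathcal S_{\rm cor}$) there is no further constraint; in the independent case ($\Sigma\in\mathcal S_{\rm ind}$) the blocks $\Sigma_{\chi w},\Sigma_{\chi\hat w},\Sigma_{w\chi},\Sigma_{\hat w\chi}$ are moreover required to vanish. **Theorem.** Suppose that $\mathcal A$ is stable, i.e. every complex eigenvalue of $\mathcal A$ has modulus less than $1$. Then, in the correlated case as well as in the independent case, the worst-case stochastic problem and the moment relaxation are both feasible, and their optimal values (suprema) coincide. -/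

import Mathlib

open MeasureTheory ProbabilityTheory Filter Topology
open scoped Matrix

namespace DRControl

/-- System matrices of the generalized plant
`x⁺ = A x + Bw w + Bu u`, `z = Cz x + Dzw w + Dzu u`, `y = Cy x + Dyw w`. -/
structure Plant (nx nw nu nz ny : ℕ) where
  A : Matrix (Fin nx) (Fin nx) ℝ
  Bw : Matrix (Fin nx) (Fin nw) ℝ
  Bu : Matrix (Fin nx) (Fin nu) ℝ
  Cz : Matrix (Fin nz) (Fin nx) ℝ
  Dzw : Matrix (Fin nz) (Fin nw) ℝ
  Dzu : Matrix (Fin nz) (Fin nu) ℝ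
  Cy : Matrix (Fin ny) (Fin nx) ℝ
  Dyw : Matrix (Fin ny) (Fin nw) ℝ

/-- Matrices of the dynamic output feedback controller
`xc⁺ = Ac xc + Bc y`, `u = Cc xc + Dc y`. -/
structure Controller (nx nu ny : ℕ) where
  Ac : Matrix (Fin nx) (Fin nx) ℝ
  Bc : Matrix (Fin nx) (Fin ny) ℝ
  Cc : Matrix (Fin nu) (Fin nx) ℝ
  Dc : Matrix (Fin nu) (Fin ny) ℝ

/-- A linear system `χ⁺ = 𝒜 χ + ℬ w`, `z = 𝒞 χ + 𝒟 w` with finite index types for the coordinates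
of `χ`, `w` and `z`. -/
structure LinSys (X W Z : Type) where
  A : Matrix X X ℝ
  B : Matrix X W ℝ
  C : Matrix Z X ℝ
  D : Matrix Z W ℝ

/-- The closed loop of plant and controller; its state is `χ = (x, xc)`. -/
def closedLoop {nx nw nu nz ny : ℕ} (G : Plant nx nw nu nz ny) (K : Controller nx nu ny) :
    LinSys (Fin nx ⊕ Fin nx) (Fin nw) (Fin nz) where
  A := Matrix.fromBlocks (G.A + G.Bu * K.Dc * G.Cy) (G.Bu * K.Cc) (K.Bc * G.Cy) K.Ac
  B := Matrix.fromRows (G.Bw + G.Bu * K.Dc * G.Dyw) (K.Bc * G.Dyw)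
  C := Matrix.fromCols (G.Cz + G.Dzu * K.Dc * G.Cy) (G.Dzu * K.Cc)
  D := G.Dzw + G.Dzu * K.Dc * G.Dyw

/-- Discrete-time (Schur) stability: every complex eigenvalue lies in the open unit disc. -/
def IsStable {X : Type} [Fintype X] [DecidableEq X] (A : Matrix X X ℝ) : Prop :=
  ∀ μ ∈ spectrum ℂ (A.map (algebraMap ℝ ℂ)), ‖μ‖ < 1

/-- The two kinds of disturbances: arbitrarily correlated in time (`cor`), or independent in time
with zero mean (`ind`). -/
inductive DisturbanceKind where
  | cor
  | ind

/-- The second moment matrix `∫ v vᵀ dμ(v)`. -/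
noncomputable def secondMoment {W : Type} [Fintype W] (μ : Measure (EuclideanSpace ℝ W)) :
    Matrix W W ℝ :=
  Matrix.of fun i j => ∫ v, v i * v j ∂μ

/-- The state process `χ(0) = 0`, `χ(t+1) = 𝒜 χ(t) + ℬ w(t)`. -/
noncomputable def stateTraj {X W Z : Type} [Fintype X] [Fintype W] (S : LinSys X W Z)
    {Ω : Type*} (w : ℕ → Ω → EuclideanSpace ℝ W) : ℕ → Ω → EuclideanSpace ℝ X
  | 0 => fun _ => 0
  | t + 1 => fun ω =>
      WithLp.toLp 2 (S.A *ᵥ (stateTraj S w t ω).ofLp + S.B *ᵥ (w t ω).ofLp)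

/-- The output process `z(t) = 𝒞 χ(t) + 𝒟 w(t)`. -/
noncomputable def outputTraj {X W Z : Type} [Fintype X] [Fintype W] (S : LinSys X W Z)
    {Ω : Type*} (w : ℕ → Ω → EuclideanSpace ℝ W) (t : ℕ) (ω : Ω) : EuclideanSpace ℝ Z :=
  WithLp.toLp 2 (S.C *ᵥ (stateTraj S w t ω).ofLp + S.D *ᵥ (w t ω).ofLp)

/-- The long-run average cost `limsup_{T → ∞} (1/T) ∑_{t < T} 𝔼‖z(t)‖²`, an extended real. -/
noncomputable def averageCost {X W Z : Type} [Fintype X] [Fintype W] [Fintype Z]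
    (S : LinSys X W Z) {Ω : Type*} [MeasurableSpace Ω] (P : Measure Ω)
    (w : ℕ → Ω → EuclideanSpace ℝ W) : EReal :=
  limsup (fun T : ℕ =>
    (((1 / (T : ℝ)) * ∑ t ∈ Finset.range T, ∫ ω, ‖outputTraj S w t ω‖ ^ 2 ∂P : ℝ) : EReal))
    atTop

/-- The additional constraint on the disturbance process: none for `cor`; mutual independence over
time and zero mean for `ind`. -/
def DisturbanceKind.Admits {W : Type} [Fintype W] {Ω : Type*} [MeasurableSpace Ω]
    (P : Measure Ω) (w : ℕ → Ω → EuclideanSpace ℝ W) : DisturbanceKind → Prop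
  | .cor => True
  | .ind => iIndepFun w P ∧ ∀ t, ∫ ω, w t ω ∂P = 0

/-- Feasibility of a pair `(w, ŵ)` for the worst-case disturbance problem. -/
structure WorstCaseFeasible {W : Type} [Fintype W] (k : DisturbanceKind) {Ω : Type*}
    [MeasurableSpace Ω] (P : Measure Ω) (γ : ℝ) (Pnom : Measure (EuclideanSpace ℝ W))
    (w what : ℕ → Ω → EuclideanSpace ℝ W) : Prop where
  memLp_w : ∀ t, MemLp (w t) 2 P
  memLp_what : ∀ t, MemLp (what t) 2 P
  dist_le : ∀ t, ∫ ω, ‖w t ω - what t ω‖ ^ 2 ∂P ≤ γ ^ 2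
  law_what : ∀ t, P.map (what t) = Pnom
  admits : k.Admits P w

/-- Optimal value of the worst-case disturbance problem. -/
noncomputable def worstCaseValue {X W Z : Type} [Fintype X] [Fintype W] [Fintype Z]
    (S : LinSys X W Z) (k : DisturbanceKind) {Ω : Type*} [MeasurableSpace Ω] (P : Measure Ω)
    (γ : ℝ) (Pnom : Measure (EuclideanSpace ℝ W)) : EReal :=
  sSup {c | ∃ w what : ℕ → Ω → EuclideanSpace ℝ W,
    WorstCaseFeasible k P γ Pnom w what ∧ c = averageCost S P w}

/-- The structural constraint `Σ ∈ 𝒮`, where `Σ` is partitioned along `(χ, (w, ŵ))`: none for `cor`;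
vanishing `χw`-, `χŵ`-, `wχ`- and `ŵχ`-blocks for `ind`. -/
def DisturbanceKind.momentSet (X W : Type) :
    DisturbanceKind → Set (Matrix (X ⊕ (W ⊕ W)) (X ⊕ (W ⊕ W)) ℝ)
  | .cor => Set.univ
  | .ind => {M | M.toBlocks₁₂ = 0 ∧ M.toBlocks₂₁ = 0}

/-- The block row `(𝒜 ℬ 0)`. -/
def LinSys.rowAB {X W Z : Type} (S : LinSys X W Z) : Matrix X (X ⊕ (W ⊕ W)) ℝ :=
  Matrix.fromCols S.A (Matrix.fromCols S.B 0)

/-- The block row `(𝒞 𝒟 0)`. -/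
def LinSys.rowCD {X W Z : Type} (S : LinSys X W Z) : Matrix Z (X ⊕ (W ⊕ W)) ℝ :=
  Matrix.fromCols S.C (Matrix.fromCols S.D 0)

/-- The block row `(I 0 0)`. -/
def selState (X W : Type) [DecidableEq X] : Matrix X (X ⊕ (W ⊕ W)) ℝ :=
  Matrix.fromCols 1 (Matrix.fromCols 0 0)

/-- The block matrix `(0 I 0; 0 0 I)`. -/
def selDist (X W : Type) [DecidableEq W] : Matrix (W ⊕ W) (X ⊕ (W ⊕ W)) ℝ :=
  Matrix.fromRows (Matrix.fromCols 0 (Matrix.fromCols 1 0))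
    (Matrix.fromCols 0 (Matrix.fromCols 0 1))

/-- The block row `(0 0 I)`. -/
def selNom (X W : Type) [DecidableEq W] : Matrix W (X ⊕ (W ⊕ W)) ℝ :=
  Matrix.fromCols 0 (Matrix.fromCols 0 1)

/-- Feasibility of `M = Σ` for the moment relaxation. -/
structure MomentFeasible {X W Z : Type} [Fintype X] [DecidableEq X] [Fintype W] [DecidableEq W]
    (S : LinSys X W Z) (k : DisturbanceKind) (γ : ℝ) (Snom : Matrix W W ℝ)
    (M : Matrix (X ⊕ (W ⊕ W)) (X ⊕ (W ⊕ W)) ℝ) : Prop where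
  mem_momentSet : M ∈ k.momentSet X W
  stationary : selState X W * M * (selState X W)ᵀ = S.rowAB * M * S.rowABᵀ
  dist_le :
    (selDist X W * M * (selDist X W)ᵀ * Matrix.fromBlocks 1 (-1) (-1) 1).trace ≤ γ ^ 2
  nominal : Snom = selNom X W * M * (selNom X W)ᵀ
  posSemidef : M.PosSemidef

/-- Optimal value of the moment relaxation. -/
noncomputable def momentValue {X W Z : Type} [Fintype X] [DecidableEq X] [Fintype W]
    [DecidableEq W] [Fintype Z] (S : LinSys X W Z) (k : DisturbanceKind) (γ : ℝ)
    (Snom : Matrix W W ℝ) : EReal :=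
  sSup {c | ∃ M : Matrix (X ⊕ (W ⊕ W)) (X ⊕ (W ⊕ W)) ℝ,
    MomentFeasible S k γ Snom M ∧ c = (((S.rowCD * M * S.rowCDᵀ).trace : ℝ) : EReal)}

end DRControl

/-! Cost and constraints of the relaxation are linear in `Σ`, and `L * Σ * Lᵀ` is the second moment
matrix of `L ζ` whenever `Σ = 𝔼 ζζᵀ` (`gram_mulVec`). Both inequalities translate between signals `ζ
= (χ, w, ŵ)` and their moments.

The relaxation is an upper bound: along a feasible disturbance, stability bounds the moments of
`ζ(t)` uniformly in `t`. Their time averages satisfy every constraint except stationarity, whose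
defect telescopes to `O(1/T)`. By compactness a limit point exists; it is feasible and its cost is
at least every level that the averaged cost reaches infinitely often
(`exists_momentFeasible_of_averages`).

The bound is reached: least squares writes a feasible `Σ` as the second moment of `(x, K x + Rᵀ e)`
with standardized noise `e` uncorrelated with `x` (`exists_regression`). Driving the system by `(w,
ŵ)(t) = K x(t) + Rᵀ e(t+1)` with i.i.d. Gaussian `e` keeps the moments equal to `Σ` at all times, by
stationarity (`gram_feedbackSignal`). Then `ŵ(t)` is a centered Gaussian with second moment `Σ_nom`,
hence has the nominal law. Starting at `χ(0) = 0` instead of `x(0)` alters the output by a transient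
that stability kills. In the independent case `K = 0`, so `w(t)` is a function of `e(t+1)` alone.
Atomlessness provides the sequence `e` (`exists_iIndepFun_map_eq`). -/

namespace DRControl

/-! ### Uniform variables and i.i.d. sequences on an atomless space -/

/-- On an atomless probability space with a countably separated σ-algebra there is a uniformly
distributed random variable. -/
theorem exists_measurable_map_eq_volume_unitInterval {Ω : Type*} [MeasurableSpace Ω]
    [MeasurableSpace.CountablySeparated Ω] (P : Measure Ω) [IsProbabilityMeasure P]
    [NullSingletonClass P] :
    ∃ U : Ω → unitInterval, Measurable U ∧ P.map U = volume := by
  -- An injective measurable map to `ℝ` carries `P` to a law `ν` without atoms; `U` is its image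
  -- under the distribution function of `ν`.
  obtain ⟨g, hg, hginj⟩ := MeasurableSpace.measurable_injection_nat_bool_of_countablySeparated Ω
  let f : Ω → ℝ := fun ω => embeddingReal (ℕ → Bool) (g ω)
  have hf : Measurable f := (measurableEmbedding_embeddingReal _).measurable.comp hg
  have hfinj : Function.Injective f :=
    (measurableEmbedding_embeddingReal (ℕ → Bool)).injective.comp hginj
  let ν := P.map f
  have hν : IsProbabilityMeasure ν := Measure.isProbabilityMeasure_map hf.aemeasurable
  have hν0 : ∀ x, ν {x} = 0 := by
    intro x
    rw [Measure.map_apply hf (measurableSet_singleton x)]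
    exact Set.Subsingleton.measure_zero (Set.subsingleton_singleton.preimage hfinj) P
  -- The jump of the distribution function at `x` is `ν {x} = 0`.
  have hcont : Continuous (cdf ν) := by
    rw [continuous_iff_continuousAt]
    intro x
    rw [(monotone_cdf ν).continuousAt_iff_leftLim_eq_rightLim, StieltjesFunction.rightLim_eq]
    refine le_antisymm ((monotone_cdf ν).leftLim_le le_rfl) ?_
    have h := (cdf ν).measure_singleton x
    rw [measure_cdf, hν0, eq_comm, ENNReal.ofReal_eq_zero] at h
    linarith
  have hmeas : Measurable (cdf ν) := (monotone_cdf ν).measurable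
  have hsurj : ∀ u : ℝ, 0 < u → u < 1 → ∃ x, cdf ν x = u := by
    intro u h0 h1
    obtain ⟨a, ha⟩ := ((tendsto_cdf_atBot ν).eventually_lt_const h0).exists
    obtain ⟨b, hb⟩ := ((tendsto_cdf_atTop ν).eventually_const_lt h1).exists
    exact mem_range_of_exists_le_of_exists_ge hcont ⟨a, ha.le⟩ ⟨b, hb.le⟩
  have hlt : ∀ u : ℝ, 0 < u → u < 1 → ν {x | cdf ν x < u} ≤ ENNReal.ofReal u := by
    intro u h0 h1
    obtain ⟨x, rfl⟩ := hsurj u h0 h1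
    rw [ofReal_cdf]
    refine measure_mono fun y hy => ?_
    by_contra h
    exact absurd (monotone_cdf ν (not_le.1 h).le) (not_le.2 hy)
  have hle : ∀ u : ℝ, 0 ≤ u → u ≤ 1 → ν {x | cdf ν x ≤ u} = ENNReal.ofReal u := by
    intro u h0 h1
    apply le_antisymm
    · rcases h1.eq_or_lt with rfl | h1
      · simpa using prob_le_one
      -- Letting `v ↓ u` in the bound for `{cdf < v}` handles plateaus of the distribution function
      -- at height `u`.
      have ht : Tendsto ENNReal.ofReal (𝓝[>] u) (𝓝 (ENNReal.ofReal u)) :=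
        (ENNReal.continuous_ofReal.tendsto u).mono_left nhdsWithin_le_nhds
      refine ge_of_tendsto ht ?_
      filter_upwards [Ioo_mem_nhdsGT h1] with v hv
      exact (measure_mono fun y hy => lt_of_le_of_lt hy hv.1).trans
        (hlt v (h0.trans_lt hv.1) hv.2)
    · rcases h0.eq_or_lt with rfl | h0
      · simp
      rcases h1.eq_or_lt with rfl | h1
      · simp [cdf_le_one]
      obtain ⟨x, rfl⟩ := hsurj u h0 h1
      rw [ofReal_cdf]
      exact measure_mono fun y hy => monotone_cdf ν hy
  have hmem : ∀ ω, cdf ν (f ω) ∈ unitInterval := fun ω => ⟨cdf_nonneg ν _, cdf_le_one ν _⟩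
  have hU : Measurable fun ω => (⟨cdf ν (f ω), hmem ω⟩ : unitInterval) :=
    (hmeas.comp hf).subtype_mk
  refine ⟨_, hU, ?_⟩
  refine Measure.ext_of_Iic _ _ fun u => ?_
  rw [Measure.map_apply hU measurableSet_Iic, unitInterval.volume_Iic,
    ← hle u u.2.1 u.2.2, Measure.map_apply hf (measurableSet_le hmeas measurable_const)]
  rfl

/-- An atomless probability space with a countably separated σ-algebra carries an i.i.d. sequence
of every law on a standard Borel space. -/
theorem exists_iIndepFun_map_eq {Ω Y : Type*} [MeasurableSpace Ω]
    [MeasurableSpace.CountablySeparated Ω] (P : Measure Ω) [IsProbabilityMeasure P]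
    [NullSingletonClass P] [MeasurableSpace Y] [StandardBorelSpace Y] (μ : Measure Y)
    [IsProbabilityMeasure μ] :
    ∃ e : ℕ → Ω → Y, (∀ n, Measurable (e n)) ∧ (∀ n, P.map (e n) = μ) ∧ iIndepFun e P := by
  obtain ⟨U, hU, hUP⟩ := exists_measurable_map_eq_volume_unitInterval P
  have : Nonempty Y := nonempty_of_isProbabilityMeasure μ
  -- The infinite product law is itself an image of the uniform law, so one uniform variable encodes
  -- the whole sequence.
  obtain ⟨f, hf, hfμ⟩ := (Measure.infinitePi fun _ : ℕ => μ).exists_measurable_map_eq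
  have hmap : P.map (fun ω n => f (U ω) n) = Measure.infinitePi fun _ : ℕ => μ := by
    rw [← hfμ, ← hUP, Measure.map_map hf hU]
    rfl
  have hm : ∀ n, Measurable fun ω => f (U ω) n := fun n =>
    (measurable_pi_apply n).comp (hf.comp hU)
  have hlaw : ∀ n, P.map (fun ω => f (U ω) n) = μ := by
    intro n
    rw [← Measure.infinitePi_map_eval (fun _ : ℕ => μ) n, ← hmap,
      Measure.map_map (measurable_pi_apply n) (measurable_pi_lambda _ hm)]
    rfl
  refine ⟨fun n ω => f (U ω) n, hm, hlaw, ?_⟩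
  rw [iIndepFun_iff_map_fun_eq_infinitePi_map hm]
  simp_rw [hlaw]
  exact hmap

/-! ### Second moment matrices -/

/-- The second moment matrix `𝔼 f fᵀ` of a random vector. -/
noncomputable def gram {Ω ι : Type*} [MeasurableSpace Ω] (P : Measure Ω) (f : Ω → ι → ℝ) :
    Matrix ι ι ℝ :=
  Matrix.of fun i j => ∫ ω, f ω i * f ω j ∂P

section Gram

variable {Ω ι κ : Type*} [MeasurableSpace Ω] {P : Measure Ω}

theorem gram_apply (f : Ω → ι → ℝ) (i j : ι) : gram P f i j = ∫ ω, f ω i * f ω j ∂P := rfl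

theorem integrable_mul_of_memLp_two {f g : Ω → ℝ} (hf : MemLp f 2 P) (hg : MemLp g 2 P) :
    Integrable (fun ω => f ω * g ω) P :=
  hf.integrable_mul hg

theorem memLp_mulVec [Fintype ι] (L : Matrix κ ι ℝ) {f : Ω → ι → ℝ}
    (hf : ∀ i, MemLp (fun ω => f ω i) 2 P) (k : κ) :
    MemLp (fun ω => (L *ᵥ f ω) k) 2 P := by
  simp only [Matrix.mulVec, dotProduct]
  exact memLp_finsetSum _ fun i _ => (hf i).const_mul _

theorem integral_mulVec_mul [Fintype ι] (L : Matrix κ ι ℝ) {f : Ω → ι → ℝ} {g : Ω → ℝ}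
    (hf : ∀ i, MemLp (fun ω => f ω i) 2 P) (hg : MemLp g 2 P) (k : κ) :
    ∫ ω, (L *ᵥ f ω) k * g ω ∂P = ∑ i, L k i * ∫ ω, f ω i * g ω ∂P := by
  simp only [Matrix.mulVec, dotProduct, Finset.sum_mul, mul_assoc]
  rw [integral_finsetSum _ fun i _ => (integrable_mul_of_memLp_two (hf i) hg).const_mul _]
  simp only [integral_const_mul]

/-- Bilinearity of second moments: this is the dictionary between linear maps of signals and
congruences of moment matrices. -/
theorem gram_mulVec [Fintype ι] (L : Matrix κ ι ℝ) {f : Ω → ι → ℝ}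
    (hf : ∀ i, MemLp (fun ω => f ω i) 2 P) :
    gram P (fun ω => L *ᵥ f ω) = L * gram P f * Lᵀ := by
  ext k l
  rw [gram_apply, integral_mulVec_mul L hf (memLp_mulVec L hf l), Matrix.mul_assoc,
    Matrix.mul_apply]
  refine Finset.sum_congr rfl fun i _ => ?_
  congr 1
  simp_rw [mul_comm (f _ i)]
  rw [integral_mulVec_mul L hf (hf i), Matrix.mul_apply]
  refine Finset.sum_congr rfl fun j _ => ?_
  rw [Matrix.transpose_apply, mul_comm, gram_apply]
  simp_rw [mul_comm (f _ j)]

theorem trace_gram [Fintype ι] {f : Ω → ι → ℝ} (hf : ∀ i, MemLp (fun ω => f ω i) 2 P) :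
    (gram P f).trace = ∫ ω, ‖WithLp.toLp 2 (f ω)‖ ^ 2 ∂P := by
  simp only [EuclideanSpace.real_norm_sq_eq, Matrix.trace, Matrix.diag, gram_apply, ← sq]
  rw [integral_finsetSum _ fun i _ => (hf i).integrable_sq]

theorem posSemidef_gram [Fintype ι] {f : Ω → ι → ℝ} (hf : ∀ i, MemLp (fun ω => f ω i) 2 P) :
    (gram P f).PosSemidef := by
  refine Matrix.PosSemidef.of_dotProduct_mulVec_nonneg ?_ fun v => ?_
  · ext i j
    simp only [Matrix.conjTranspose_apply, gram_apply, star_trivial, mul_comm]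
  · have h : star v ⬝ᵥ gram P f *ᵥ v
        = gram P (fun ω => (Matrix.of fun _ : Unit => v) *ᵥ f ω) () () := by
      rw [gram_mulVec _ hf, Matrix.mul_assoc, Matrix.mul_apply]
      simp [dotProduct, Matrix.mul_apply, Matrix.mulVec]
    rw [h, gram_apply]
    exact integral_nonneg fun ω => mul_self_nonneg _

theorem abs_integral_mul_le {f g : Ω → ℝ} (hf : MemLp f 2 P) (hg : MemLp g 2 P) :
    |∫ ω, f ω * g ω ∂P| ≤ ((∫ ω, f ω ^ 2 ∂P) + ∫ ω, g ω ^ 2 ∂P) / 2 := by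
  rw [← integral_add hf.integrable_sq hg.integrable_sq, ← integral_div]
  refine (abs_integral_le_integral_abs).trans
    (integral_mono (integrable_mul_of_memLp_two hf hg).abs
      ((hf.integrable_sq.add hg.integrable_sq).div_const 2) fun ω => ?_)
  simp only [abs_mul]
  nlinarith [sq_nonneg (|f ω| - |g ω|), sq_abs (f ω), sq_abs (g ω)]

theorem abs_gram_le {f : Ω → ι → ℝ} (hf : ∀ i, MemLp (fun ω => f ω i) 2 P) {c : ℝ}
    (hc : ∀ i, ∫ ω, f ω i ^ 2 ∂P ≤ c) (i j : ι) : |gram P f i j| ≤ c :=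
  (abs_integral_mul_le (hf i) (hf j)).trans (by linarith [hc i, hc j])

theorem gram_sumElim {f : Ω → ι → ℝ} {g : Ω → κ → ℝ}
    (h : ∀ i j, ∫ ω, f ω i * g ω j ∂P = 0) :
    gram P (fun ω => Sum.elim (f ω) (g ω)) = Matrix.fromBlocks (gram P f) 0 0 (gram P g) := by
  ext (i | i) (j | j)
  · rfl
  · exact h i j
  · simpa [gram_apply, mul_comm] using h j i
  · rfl

/-- A linear combination with coefficients of total mass at most `q` of functions bounded in `L²`
is bounded in `L²`. -/
theorem integral_mulVec_sq_le [Fintype ι] (L : Matrix κ ι ℝ) {f : Ω → ι → ℝ}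
    (hf : ∀ i, MemLp (fun ω => f ω i) 2 P) {c : ℝ} (hc0 : 0 ≤ c)
    (hc : ∀ i, ∫ ω, f ω i ^ 2 ∂P ≤ c) {k : κ} {q : ℝ} (hq : ∑ i, |L k i| ≤ q) :
    ∫ ω, (L *ᵥ f ω) k ^ 2 ∂P ≤ q ^ 2 * c := by
  have h : ∫ ω, (L *ᵥ f ω) k ^ 2 ∂P = ∑ j, (∑ i, L k i * gram P f i j) * L k j := by
    simp_rw [sq]
    rw [← gram_apply (fun ω => L *ᵥ f ω), gram_mulVec L hf]
    simp [Matrix.mul_apply]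
  have h0 : 0 ≤ ∑ i, |L k i| := Finset.sum_nonneg fun i _ => abs_nonneg _
  calc ∫ ω, (L *ᵥ f ω) k ^ 2 ∂P ≤ ∑ j, (∑ i, |L k i| * c) * |L k j| := by
        rw [h]
        refine Finset.sum_le_sum fun j _ => (le_abs_self _).trans ?_
        rw [abs_mul]
        refine mul_le_mul_of_nonneg_right ((Finset.abs_sum_le_sum_abs _ _).trans
          (Finset.sum_le_sum fun i _ => ?_)) (abs_nonneg _)
        rw [abs_mul]
        exact mul_le_mul_of_nonneg_left (abs_gram_le hf hc i j) (abs_nonneg _)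
    _ = (∑ i, |L k i|) ^ 2 * c := by
        rw [← Finset.mul_sum, ← Finset.sum_mul]
        ring
    _ ≤ q ^ 2 * c := by gcongr

end Gram

/-! ### Geometric decay for Schur stable matrices -/

section Stability

attribute [local instance] Matrix.linftyOpNormedRing Matrix.linftyOpNormedAlgebra

/-- Gelfand's formula: for `r` between the spectral radius and `1`, the powers are eventually below
`r ^ k`; finitely many exceptions go into the constant. -/
theorem IsStable.exists_norm_map_pow_le {X : Type} [Fintype X] [DecidableEq X]
    {A : Matrix X X ℝ} (hA : IsStable A) :
    ∃ C r : ℝ, 0 ≤ C ∧ 0 ≤ r ∧ r < 1 ∧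
      ∀ k : ℕ, ‖(A.map (algebraMap ℝ ℂ)) ^ k‖ ≤ C * r ^ k := by
  cases isEmpty_or_nonempty X
  · refine ⟨0, 0, le_rfl, le_rfl, one_pos, fun k => ?_⟩
    rw [Subsingleton.elim ((A.map (algebraMap ℝ ℂ)) ^ k) 0]
    simp
  set A' := A.map (algebraMap ℝ ℂ)
  have hρ : spectralRadius ℂ A' < ((1 : NNReal) : ENNReal) :=
    spectrum.spectralRadius_lt_of_forall_lt _ fun z hz => hA z hz
  obtain ⟨r, h1, h2⟩ := ENNReal.lt_iff_exists_nnreal_btwn.1 hρ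
  have hr1 : r < 1 := by exact_mod_cast h2
  have hev :=
    (spectrum.pow_nnnorm_pow_one_div_tendsto_nhds_spectralRadius A').eventually_lt_const h1
  obtain ⟨N, hN⟩ := eventually_atTop.1 (hev.and (eventually_gt_atTop 0))
  have hr0 : 0 < r := by
    have : (0 : ENNReal) < r := bot_le.trans_lt h1
    exact_mod_cast this
  have hlarge : ∀ k, N ≤ k → ‖A' ^ k‖ ≤ (r : ℝ) ^ k := by
    intro k hk
    obtain ⟨h, hk0⟩ := hN k hk
    have hk0' : (k : ℝ) ≠ 0 := by positivity
    have h' := ENNReal.rpow_lt_rpow h (z := k) (by positivity)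
    rw [← ENNReal.rpow_mul, one_div, inv_mul_cancel₀ hk0', ENNReal.rpow_one,
      ENNReal.rpow_natCast] at h'
    have h'' : ‖A' ^ k‖₊ < r ^ k := by exact_mod_cast h'
    exact_mod_cast h''.le
  -- The summand `1` serves the powers `k ≥ N`, the sum serves each `k < N`.
  refine ⟨1 + ∑ k ∈ Finset.range N, ‖A' ^ k‖ / (r : ℝ) ^ k, r, by positivity, r.2,
    by exact_mod_cast hr1, fun k => ?_⟩
  have hrk : (0 : ℝ) < (r : ℝ) ^ k := by positivity
  have hs : 0 ≤ ∑ k ∈ Finset.range N, ‖A' ^ k‖ / (r : ℝ) ^ k := by positivity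
  rcases le_or_gt N k with hk | hk
  · nlinarith [hlarge k hk]
  · rw [← div_le_iff₀ hrk]
    have := Finset.single_le_sum (f := fun k => ‖A' ^ k‖ / (r : ℝ) ^ k)
      (fun _ _ => by positivity) (Finset.mem_range.2 hk)
    linarith

/-- Powers of a Schur stable matrix decay geometrically. -/
theorem IsStable.exists_abs_pow_le {X : Type} [Fintype X] [DecidableEq X]
    {A : Matrix X X ℝ} (hA : IsStable A) :
    ∃ C r : ℝ, 0 ≤ C ∧ 0 ≤ r ∧ r < 1 ∧ ∀ (k : ℕ) (i j : X), |(A ^ k) i j| ≤ C * r ^ k := by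
  obtain ⟨C, r, hC, hr, hr1, h⟩ := hA.exists_norm_map_pow_le
  refine ⟨C, r, hC, hr, hr1, fun k i j => ?_⟩
  have h1 : ‖((A.map (algebraMap ℝ ℂ)) ^ k) i j‖ = |(A ^ k) i j| := by
    rw [← Matrix.map_pow]
    simp
  rw [← h1]
  refine le_trans ?_ (h k)
  rw [Matrix.linfty_opNorm_def, ← coe_nnnorm, NNReal.coe_le_coe]
  exact (Finset.single_le_sum (f := fun j => ‖((A.map (algebraMap ℝ ℂ)) ^ k) i j‖₊)
    (fun _ _ => zero_le) (Finset.mem_univ j)).trans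
    (Finset.le_sup (f := fun i => ∑ j, ‖((A.map (algebraMap ℝ ℂ)) ^ k) i j‖₊) (Finset.mem_univ i))

end Stability

theorem IsStable.tendsto_pow {X : Type} [Fintype X] [DecidableEq X]
    {A : Matrix X X ℝ} (hA : IsStable A) : Tendsto (fun k : ℕ => A ^ k) atTop (𝓝 0) := by
  obtain ⟨C, r, -, hr, hr1, h⟩ := hA.exists_abs_pow_le
  refine tendsto_pi_nhds.2 fun i => tendsto_pi_nhds.2 fun j => ?_
  refine squeeze_zero_norm (fun k => h k i j) ?_
  simpa using (tendsto_pow_atTop_nhds_zero_of_lt_one hr hr1).const_mul C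

/-- The impulse response is absolutely summable by comparison with a geometric series, so its row
sums are bounded uniformly in the horizon `t`. -/
theorem IsStable.exists_sum_abs_pow_mul_le {X W : Type} [Fintype X] [DecidableEq X] [Fintype W]
    {A : Matrix X X ℝ} (hA : IsStable A) (B : Matrix X W ℝ) :
    ∃ q : ℝ, ∀ (t : ℕ) (i : X), ∑ s : Fin t, ∑ j, |(A ^ (t - 1 - s) * B) i j| ≤ q := by
  obtain ⟨C, r, hC, hr, hr1, h⟩ := hA.exists_abs_pow_le
  set b := ∑ j, ∑ l, |B l j|
  have hb : 0 ≤ b := by positivity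
  refine ⟨C * b * (1 - r)⁻¹, fun t i => ?_⟩
  have h1 : ∀ k : ℕ, ∑ j, |(A ^ k * B) i j| ≤ C * b * r ^ k := by
    intro k
    calc ∑ j, |(A ^ k * B) i j| ≤ ∑ j, ∑ l, C * r ^ k * |B l j| := by
          refine Finset.sum_le_sum fun j _ => ?_
          rw [Matrix.mul_apply]
          refine (Finset.abs_sum_le_sum_abs _ _).trans (Finset.sum_le_sum fun l _ => ?_)
          rw [abs_mul]
          exact mul_le_mul_of_nonneg_right (h k i l) (abs_nonneg _)
      _ = C * b * r ^ k := by
          simp_rw [← Finset.mul_sum]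
          ring
  calc ∑ s : Fin t, ∑ j, |(A ^ (t - 1 - s) * B) i j|
      ≤ ∑ s : Fin t, C * b * r ^ (t - 1 - (s : ℕ)) := Finset.sum_le_sum fun s _ => h1 _
    _ = C * b * ∑ k ∈ Finset.range t, r ^ k := by
        rw [← Finset.mul_sum, Fin.sum_univ_eq_sum_range fun s => r ^ (t - 1 - s),
          Finset.sum_range_reflect]
    _ ≤ C * b * (1 - r)⁻¹ := by
        refine mul_le_mul_of_nonneg_left ?_ (mul_nonneg hC hb)
        exact ((summable_geometric_of_lt_one hr hr1).sum_le_tsum _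
          (fun k _ => pow_nonneg hr k)).trans (tsum_geometric_of_lt_one hr hr1).le

/-! ### Limit points of time averages -/

section Compactness

variable {X W Z : Type}

theorem isClosed_momentSet (k : DisturbanceKind) : IsClosed (k.momentSet X W) := by
  cases k
  · exact isClosed_univ
  · refine IsClosed.and ?_ ?_
    · exact isClosed_eq (by unfold Matrix.toBlocks₁₂; fun_prop) continuous_const
    · exact isClosed_eq (by unfold Matrix.toBlocks₂₁; fun_prop) continuous_const

theorem average_mem_momentSet {k : DisturbanceKind} {N : ℕ → Matrix (X ⊕ (W ⊕ W)) (X ⊕ (W ⊕ W)) ℝ}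
    (hN : ∀ t, N t ∈ k.momentSet X W) (r : ℝ) (T : ℕ) :
    r • ∑ t ∈ Finset.range T, N t ∈ k.momentSet X W := by
  cases k
  · trivial
  · constructor
    · ext i j
      have h : ∀ t, N t (Sum.inl i) (Sum.inr j) = 0 := fun t => congrFun₂ (hN t).1 i j
      simp [Matrix.toBlocks₁₂, Matrix.sum_apply, h]
    · ext i j
      have h : ∀ t, N t (Sum.inr i) (Sum.inl j) = 0 := fun t => congrFun₂ (hN t).2 i j
      simp [Matrix.toBlocks₂₁, Matrix.sum_apply, h]

theorem isClosed_posSemidef {n : Type*} [Fintype n] :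
    IsClosed {M : Matrix n n ℝ | M.PosSemidef} := by
  simp only [Matrix.posSemidef_iff_dotProduct_mulVec, Matrix.IsHermitian, Set.ofPred_and,
    Set.ofPred_forall]
  refine IsClosed.inter (isClosed_eq (by fun_prop) continuous_id) (isClosed_iInter fun v => ?_)
  exact isClosed_le continuous_const (by fun_prop)

theorem isCompact_abs_le {m n : Type*} (c : ℝ) :
    IsCompact {M : Matrix m n ℝ | ∀ i j, |M i j| ≤ c} := by
  have h : {M : Matrix m n ℝ | ∀ i j, |M i j| ≤ c}
      = Set.univ.pi fun _ : m => Set.univ.pi fun _ : n => Set.Icc (-c) c := by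
    ext M
    simp only [Set.mem_ofPred_eq, abs_le]
    exact ⟨fun h i _ j _ => h i j, fun h i j => h i trivial j trivial⟩
  rw [h]
  exact isCompact_univ_pi fun _ => isCompact_univ_pi fun _ => isCompact_Icc

theorem mul_average_mul {l m n : Type*} [Fintype m] [Fintype n] (L : Matrix l m ℝ)
    (N : ℕ → Matrix m n ℝ) (R : Matrix n l ℝ) (r : ℝ) (T : ℕ) :
    L * (r • ∑ t ∈ Finset.range T, N t) * R = r • ∑ t ∈ Finset.range T, L * N t * R := by
  rw [Matrix.mul_smul, Matrix.smul_mul, Matrix.mul_sum, Matrix.sum_mul]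

theorem average_const_le {T : ℕ} {f : ℕ → ℝ} {c : ℝ} (hT : 0 < T) (h : ∀ t, f t ≤ c) :
    (1 / (T : ℝ)) * ∑ t ∈ Finset.range T, f t ≤ c := by
  have hT' : (0 : ℝ) < T := by exact_mod_cast hT
  rw [one_div, inv_mul_le_iff₀ hT']
  simpa using Finset.sum_le_card_nsmul (Finset.range T) f c fun t _ => h t

/-- Limit points of time averages of bounded moment matrices along a trajectory are feasible for
the moment relaxation. -/
theorem exists_momentFeasible_of_averages [Fintype X] [DecidableEq X] [Fintype W] [DecidableEq W]
    [Fintype Z] {S : LinSys X W Z} {k : DisturbanceKind} {γ : ℝ} {Snom : Matrix W W ℝ}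
    {N : ℕ → Matrix (X ⊕ (W ⊕ W)) (X ⊕ (W ⊕ W)) ℝ} {Q : ℕ → Matrix X X ℝ} {c : ℝ}
    (hc : ∀ t i j, |N t i j| ≤ c) (hQc : ∀ t i j, |Q t i j| ≤ c)
    (hmem : ∀ t, N t ∈ k.momentSet X W)
    (hsel : ∀ t, selState X W * N t * (selState X W)ᵀ = Q t)
    (hnext : ∀ t, S.rowAB * N t * S.rowABᵀ = Q (t + 1))
    (hdist : ∀ t, (selDist X W * N t * (selDist X W)ᵀ *
      Matrix.fromBlocks 1 (-1) (-1) 1).trace ≤ γ ^ 2)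
    (hnom : ∀ t, Snom = selNom X W * N t * (selNom X W)ᵀ)
    (hpsd : ∀ t, (N t).PosSemidef) {a : EReal}
    (ha : ∃ᶠ T : ℕ in atTop, a ≤ (((1 / (T : ℝ)) *
      ∑ t ∈ Finset.range T, (S.rowCD * N t * S.rowCDᵀ).trace : ℝ) : EReal)) :
    ∃ M, MomentFeasible S k γ Snom M ∧ a ≤ (((S.rowCD * M * S.rowCDᵀ).trace : ℝ) : EReal) := by
  -- A subsequence of positive horizons along which the averaged cost stays at least `a`; a further
  -- one will make the averages converge.
  obtain ⟨φ, hφ, hφa⟩ := extraction_of_frequently_atTop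
    (ha.and_eventually (eventually_gt_atTop 0))
  set M : ℕ → Matrix (X ⊕ (W ⊕ W)) (X ⊕ (W ⊕ W)) ℝ := fun T =>
    (1 / (T : ℝ)) • ∑ t ∈ Finset.range T, N t with hM
  have hTpos : ∀ n, 0 < φ n := fun n => (hφa n).2
  have hMc : ∀ n, M (φ n) ∈ {M : Matrix (X ⊕ (W ⊕ W)) (X ⊕ (W ⊕ W)) ℝ | ∀ i j, |M i j| ≤ c} := by
    intro n i j
    have h1 : M (φ n) i j = (1 / (φ n : ℝ)) * ∑ t ∈ Finset.range (φ n), N t i j := by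
      simp [hM, Matrix.sum_apply]
    rw [h1, abs_mul, abs_of_nonneg (by positivity)]
    exact (mul_le_mul_of_nonneg_left (Finset.abs_sum_le_sum_abs _ _) (by positivity)).trans
      (average_const_le (hTpos n) fun t => hc t i j)
  have : FirstCountableTopology (Matrix (X ⊕ (W ⊕ W)) (X ⊕ (W ⊕ W)) ℝ) :=
    inferInstanceAs (FirstCountableTopology ((X ⊕ (W ⊕ W)) → (X ⊕ (W ⊕ W)) → ℝ))
  obtain ⟨M₀, -, ψ, hψ, hlim⟩ := (isCompact_abs_le c).tendsto_subseq hMc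
  have hφψ : Tendsto (fun n => (φ (ψ n) : ℝ)) atTop atTop :=
    tendsto_natCast_atTop_atTop.comp (hφ.comp hψ).tendsto_atTop
  have hcl : ∀ {s : Set (Matrix (X ⊕ (W ⊕ W)) (X ⊕ (W ⊕ W)) ℝ)}, IsClosed s →
      (∀ T, 0 < T → M T ∈ s) → M₀ ∈ s := fun hs h =>
    hs.mem_of_tendsto hlim (Eventually.of_forall fun n => h _ (hTpos (ψ n)))
  refine ⟨M₀, ⟨?_, ?_, ?_, ?_, ?_⟩, ?_⟩
  · exact hcl (isClosed_momentSet k) fun T _ => average_mem_momentSet hmem _ T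
  · have h1 : ∀ T, selState X W * M T * (selState X W)ᵀ - S.rowAB * M T * S.rowABᵀ
        = (1 / (T : ℝ)) • (Q 0 - Q T) := by
      intro T
      simp only [hM, mul_average_mul, hsel, hnext]
      rw [← smul_sub, ← Finset.sum_sub_distrib, Finset.sum_range_sub']
    have h2 : Tendsto (fun n => selState X W * M (φ (ψ n)) * (selState X W)ᵀ
        - S.rowAB * M (φ (ψ n)) * S.rowABᵀ) atTop
        (𝓝 (selState X W * M₀ * (selState X W)ᵀ - S.rowAB * M₀ * S.rowABᵀ)) :=
      ((by fun_prop : Continuous fun M : Matrix (X ⊕ (W ⊕ W)) (X ⊕ (W ⊕ W)) ℝ =>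
        selState X W * M * (selState X W)ᵀ
        - S.rowAB * M * S.rowABᵀ).tendsto M₀).comp hlim
    have h3 : Tendsto (fun n => selState X W * M (φ (ψ n)) * (selState X W)ᵀ
        - S.rowAB * M (φ (ψ n)) * S.rowABᵀ) atTop (𝓝 0) := by
      simp only [h1]
      refine tendsto_pi_nhds.2 fun i => tendsto_pi_nhds.2 fun j => ?_
      refine squeeze_zero_norm (a := fun n => 2 * c / (φ (ψ n) : ℝ)) (fun n => ?_)
        (hφψ.const_div_atTop _)
      have h4 : |Q 0 i j - Q (φ (ψ n)) i j| ≤ 2 * c :=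
        (abs_sub _ _).trans (by linarith [hQc 0 i j, hQc (φ (ψ n)) i j])
      simp only [Matrix.smul_apply, Matrix.sub_apply, smul_eq_mul, Real.norm_eq_abs, abs_mul]
      rw [abs_of_nonneg (by positivity), one_div, div_eq_inv_mul]
      exact mul_le_mul_of_nonneg_left h4 (by positivity)
    exact sub_eq_zero.1 (tendsto_nhds_unique h2 h3)
  · have hs : IsClosed {M : Matrix (X ⊕ (W ⊕ W)) (X ⊕ (W ⊕ W)) ℝ |
        (selDist X W * M * (selDist X W)ᵀ * Matrix.fromBlocks 1 (-1) (-1) 1).trace ≤ γ ^ 2} :=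
      isClosed_le (by fun_prop) continuous_const
    refine hcl hs fun T hT => ?_
    simp only [hM, Set.mem_ofPred_eq, mul_average_mul, Matrix.smul_mul, Matrix.sum_mul,
      Matrix.trace_smul, Matrix.trace_sum, smul_eq_mul]
    exact average_const_le hT hdist
  · have hs : IsClosed {M : Matrix (X ⊕ (W ⊕ W)) (X ⊕ (W ⊕ W)) ℝ |
        Snom = selNom X W * M * (selNom X W)ᵀ} := isClosed_eq continuous_const (by fun_prop)
    refine hcl hs fun T hT => ?_
    have hT' : (T : ℝ) ≠ 0 := by positivity
    simp only [hM, Set.mem_ofPred_eq, mul_average_mul, ← hnom]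
    simp [← Nat.cast_smul_eq_nsmul ℝ, smul_smul, hT']
  · refine hcl isClosed_posSemidef fun T _ => ?_
    exact (Matrix.posSemidef_sum _ fun t _ => hpsd t).smul (by positivity)
  · have h2 : Tendsto (fun n => (((S.rowCD * M (φ (ψ n)) * S.rowCDᵀ).trace : ℝ) : EReal)) atTop
        (𝓝 (((S.rowCD * M₀ * S.rowCDᵀ).trace : ℝ) : EReal)) :=
      (continuous_coe_real_ereal.tendsto _).comp
        (((by fun_prop : Continuous fun M : Matrix (X ⊕ (W ⊕ W)) (X ⊕ (W ⊕ W)) ℝ =>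
          (S.rowCD * M * S.rowCDᵀ).trace).tendsto M₀).comp hlim)
    refine ge_of_tendsto' h2 fun n => ?_
    simp only [hM, mul_average_mul, Matrix.trace_smul, Matrix.trace_sum, smul_eq_mul]
    exact (hφa (ψ n)).1

end Compactness

/-! ### Block matrix identities -/

section Blocks

variable {X W Z : Type} [Fintype X] [Fintype W]

theorem selState_mulVec [DecidableEq X] (x : X → ℝ) (d : W ⊕ W → ℝ) :
    selState X W *ᵥ Sum.elim x d = x := by
  rw [selState, Matrix.fromCols_mulVec_sumElim]
  ext i
  simp

theorem selDist_mulVec [DecidableEq W] (x : X → ℝ) (d : W ⊕ W → ℝ) :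
    selDist X W *ᵥ Sum.elim x d = d := by
  rw [← Sum.elim_comp_inl_inr d]
  simp only [selDist, Matrix.fromRows_mulVec, Matrix.fromCols_mulVec_sumElim]
  simp

theorem selNom_mulVec [DecidableEq W] (x : X → ℝ) (v v' : W → ℝ) :
    selNom X W *ᵥ Sum.elim x (Sum.elim v v') = v' := by
  simp [selNom]

theorem LinSys.rowAB_mulVec (S : LinSys X W Z) (x : X → ℝ) (v v' : W → ℝ) :
    S.rowAB *ᵥ Sum.elim x (Sum.elim v v') = S.A *ᵥ x + S.B *ᵥ v := by
  simp [LinSys.rowAB]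

theorem LinSys.rowCD_mulVec (S : LinSys X W Z) (x : X → ℝ) (v v' : W → ℝ) :
    S.rowCD *ᵥ Sum.elim x (Sum.elim v v') = S.C *ᵥ x + S.D *ᵥ v := by
  simp [LinSys.rowCD]

theorem fromCols_mul_fromBlocks_mul_transpose {m n l : Type*} [Fintype m] [Fintype n]
    (L : Matrix l m ℝ) (R : Matrix l n ℝ) (Q : Matrix m m ℝ) (T : Matrix n n ℝ) :
    Matrix.fromCols L R * Matrix.fromBlocks Q 0 0 T * (Matrix.fromCols L R)ᵀ
      = L * Q * Lᵀ + R * T * Rᵀ := by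
  rw [Matrix.fromCols_mul_fromBlocks, Matrix.transpose_fromCols, Matrix.fromCols_mul_fromRows]
  simp

/-- The weight `(1 -1; -1 1)` factors as `(1 -1)ᵀ (1 -1)`, so the trace measures the difference of
the two halves. -/
theorem trace_mul_difference [DecidableEq W] (M : Matrix (W ⊕ W) (W ⊕ W) ℝ) :
    (M * Matrix.fromBlocks 1 (-1) (-1) 1).trace
      = (Matrix.fromCols (1 : Matrix W W ℝ) (-1 : Matrix W W ℝ) * M *
        (Matrix.fromCols (1 : Matrix W W ℝ) (-1 : Matrix W W ℝ))ᵀ).trace := by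
  have h : Matrix.fromBlocks 1 (-1) (-1) (1 : Matrix W W ℝ)
      = (Matrix.fromCols (1 : Matrix W W ℝ) (-1 : Matrix W W ℝ))ᵀ *
        Matrix.fromCols (1 : Matrix W W ℝ) (-1 : Matrix W W ℝ) := by
    rw [Matrix.transpose_fromCols, Matrix.fromRows_mul_fromCols]
    simp
  rw [h, ← Matrix.mul_assoc, Matrix.trace_mul_comm, Matrix.mul_assoc]

end Blocks

/-! ### Moment matrices at a fixed time -/

section Static

variable {X W Z : Type} {Ω : Type*} [MeasurableSpace Ω] {P : Measure Ω}

theorem memLp_sumElim {ι κ : Type*} {f : Ω → ι → ℝ} {g : Ω → κ → ℝ}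
    (hf : ∀ i, MemLp (fun ω => f ω i) 2 P) (hg : ∀ i, MemLp (fun ω => g ω i) 2 P) (i : ι ⊕ κ) :
    MemLp (fun ω => Sum.elim (f ω) (g ω) i) 2 P := by
  cases i
  · exact hf _
  · exact hg _

theorem integral_sumElim_sq_le {ι κ : Type*} {f : Ω → ι → ℝ} {g : Ω → κ → ℝ} {c : ℝ}
    (hf : ∀ i, ∫ ω, f ω i ^ 2 ∂P ≤ c) (hg : ∀ i, ∫ ω, g ω i ^ 2 ∂P ≤ c) (i : ι ⊕ κ) :
    ∫ ω, Sum.elim (f ω) (g ω) i ^ 2 ∂P ≤ c := by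
  cases i
  · exact hf _
  · exact hg _

theorem trace_gram_sumElim_mul_difference [Fintype W] [DecidableEq W] {v v' : Ω → W → ℝ}
    (hv : ∀ i, MemLp (fun ω => v ω i) 2 P) (hv' : ∀ i, MemLp (fun ω => v' ω i) 2 P) :
    (gram P (fun ω => Sum.elim (v ω) (v' ω)) * Matrix.fromBlocks 1 (-1) (-1) 1).trace
      = ∫ ω, ‖WithLp.toLp 2 (v ω - v' ω)‖ ^ 2 ∂P := by
  have h : ∀ ω, Matrix.fromCols (1 : Matrix W W ℝ) (-1) *ᵥ Sum.elim (v ω) (v' ω)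
      = v ω - v' ω := by
    intro ω
    rw [Matrix.fromCols_mulVec_sumElim, Matrix.neg_mulVec, Matrix.one_mulVec, Matrix.one_mulVec,
      sub_eq_add_neg]
  rw [trace_mul_difference, ← gram_mulVec _ (memLp_sumElim hv hv')]
  simp_rw [h]
  exact trace_gram fun i => (hv i).sub (hv' i)

theorem abs_fromBlocks_diagonal_le {m n : Type*} {Q : Matrix m m ℝ} {R : Matrix n n ℝ} {c : ℝ}
    (hc : 0 ≤ c) (hQ : ∀ i j, |Q i j| ≤ c) (hR : ∀ i j, |R i j| ≤ c) (i j : m ⊕ n) :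
    |Matrix.fromBlocks Q 0 0 R i j| ≤ c := by
  rcases i with i | i <;> rcases j with j | j
  · exact hQ i j
  · simpa using hc
  · simpa using hc
  · exact hR i j

theorem posSemidef_fromBlocks_diagonal {m n : Type*} [Fintype m] [Fintype n] {Q : Matrix m m ℝ}
    {R : Matrix n n ℝ} (hQ : Q.PosSemidef) (hR : R.PosSemidef) :
    (Matrix.fromBlocks Q 0 0 R).PosSemidef := by
  refine Matrix.PosSemidef.of_dotProduct_mulVec_nonneg ?_ fun v => ?_
  · rw [Matrix.IsHermitian, Matrix.fromBlocks_conjTranspose, hQ.1, hR.1]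
    simp
  · obtain ⟨x, y, rfl⟩ : ∃ x y, v = Sum.elim x y := ⟨_, _, (Sum.elim_comp_inl_inr v).symm⟩
    have h1 := hQ.dotProduct_mulVec_nonneg x
    have h2 := hR.dotProduct_mulVec_nonneg y
    have h3 : star (Sum.elim x y) ⬝ᵥ Matrix.fromBlocks Q 0 0 R *ᵥ Sum.elim x y
        = star x ⬝ᵥ Q *ᵥ x + star y ⬝ᵥ R *ᵥ y := by
      simp [Matrix.fromBlocks_mulVec, dotProduct]
    rw [h3]
    exact add_nonneg h1 h2

/-- The second moments of `(χ, w, ŵ)`, with the off-diagonal blocks removed for independent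
disturbances. -/
theorem exists_momentMatrix [Fintype X] [DecidableEq X] [Fintype W] [DecidableEq W]
    (S : LinSys X W Z) (k : DisturbanceKind) {x : Ω → X → ℝ} {v v' : Ω → W → ℝ}
    (hx : ∀ i, MemLp (fun ω => x ω i) 2 P) (hv : ∀ i, MemLp (fun ω => v ω i) 2 P)
    (hv' : ∀ i, MemLp (fun ω => v' ω i) 2 P)
    (hk : k = .ind → ∀ i j, ∫ ω, x ω i * v ω j ∂P = 0) {c : ℝ} (hc0 : 0 ≤ c)
    (hcx : ∀ i, ∫ ω, x ω i ^ 2 ∂P ≤ c) (hcv : ∀ i, ∫ ω, v ω i ^ 2 ∂P ≤ c)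
    (hcv' : ∀ i, ∫ ω, v' ω i ^ 2 ∂P ≤ c) :
    ∃ N : Matrix (X ⊕ (W ⊕ W)) (X ⊕ (W ⊕ W)) ℝ,
      (∀ i j, |N i j| ≤ c) ∧ N ∈ k.momentSet X W ∧ N.PosSemidef ∧
      selState X W * N * (selState X W)ᵀ = gram P x ∧
      S.rowAB * N * S.rowABᵀ = gram P (fun ω => S.A *ᵥ x ω + S.B *ᵥ v ω) ∧
      S.rowCD * N * S.rowCDᵀ = gram P (fun ω => S.C *ᵥ x ω + S.D *ᵥ v ω) ∧
      selDist X W * N * (selDist X W)ᵀ = gram P (fun ω => Sum.elim (v ω) (v' ω)) ∧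
      selNom X W * N * (selNom X W)ᵀ = gram P v' := by
  have hd := memLp_sumElim hv hv'
  have hcd := integral_sumElim_sq_le hcv hcv'
  have hζ := memLp_sumElim hx hd
  cases k
  · refine ⟨gram P fun ω => Sum.elim (x ω) (Sum.elim (v ω) (v' ω)),
      abs_gram_le hζ (integral_sumElim_sq_le hcx hcd), trivial, posSemidef_gram hζ, ?_⟩
    simp only [← gram_mulVec _ hζ, selState_mulVec, selDist_mulVec, selNom_mulVec,
      LinSys.rowAB_mulVec, LinSys.rowCD_mulVec, and_self]
  -- Here `ŵ` may still be correlated with `χ`. But no constraint or cost sees the `χŵ`-block apart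
  -- from the structural one, so it may be replaced by zero; the `χw`-block vanishes by `hk`.
  · have hxv := memLp_sumElim hx hv
    have hgram : ∀ {Y : Type} (L : Matrix Y X ℝ) (R : Matrix Y W ℝ),
        L * gram P x * Lᵀ + Matrix.fromCols R (0 : Matrix Y W ℝ) *
          gram P (fun ω => Sum.elim (v ω) (v' ω)) * (Matrix.fromCols R (0 : Matrix Y W ℝ))ᵀ = gram P (fun ω => L *ᵥ x ω + R *ᵥ v ω) := by
      intro Y L R
      rw [← gram_mulVec _ hd]
      simp only [Matrix.fromCols_mulVec_sumElim, Matrix.zero_mulVec, add_zero]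
      rw [gram_mulVec _ hv, ← fromCols_mul_fromBlocks_mul_transpose, ← gram_sumElim (hk rfl),
        ← gram_mulVec _ hxv]
      simp only [Matrix.fromCols_mulVec_sumElim]
    refine ⟨Matrix.fromBlocks (gram P x) 0 0 (gram P fun ω => Sum.elim (v ω) (v' ω)),
      abs_fromBlocks_diagonal_le hc0 (abs_gram_le hx hcx) (abs_gram_le hd hcd),
      ⟨rfl, rfl⟩, posSemidef_fromBlocks_diagonal (posSemidef_gram hx) (posSemidef_gram hd),
      ?_, ?_, ?_, ?_, ?_⟩
    · rw [selState, fromCols_mul_fromBlocks_mul_transpose]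
      simp
    · rw [LinSys.rowAB, fromCols_mul_fromBlocks_mul_transpose, hgram]
    · rw [LinSys.rowCD, fromCols_mul_fromBlocks_mul_transpose, hgram]
    · have h : selDist X W = Matrix.fromCols (0 : Matrix (W ⊕ W) X ℝ) 1 := by
        ext (i | i) (j | j | j) <;> simp [selDist, Matrix.one_apply]
      rw [h, fromCols_mul_fromBlocks_mul_transpose]
      simp
    · rw [selNom, fromCols_mul_fromBlocks_mul_transpose, ← gram_mulVec _ hd]
      simp

end Static

/-! ### State trajectories as convolutions -/

section Trajectory

variable {X W Z : Type} [Fintype X] [Fintype W]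

/-- The map from the disturbance on `{0, …, t - 1}` to the state at time `t`. -/
def LinSys.convolution [DecidableEq X] (S : LinSys X W Z) (t : ℕ) : Matrix X (Fin t × W) ℝ :=
  Matrix.of fun i p => (S.A ^ (t - 1 - (p.1 : ℕ)) * S.B) i p.2

/-- Variation of constants. -/
theorem stateTraj_eq_mulVec [DecidableEq X] {Ω : Type*} (S : LinSys X W Z)
    (w : ℕ → Ω → EuclideanSpace ℝ W) (t : ℕ) (ω : Ω) :
    (stateTraj S w t ω).ofLp = S.convolution t *ᵥ fun p : Fin t × W => w p.1 ω p.2 := by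
  have h : (stateTraj S w t ω).ofLp
      = ∑ s ∈ Finset.range t, (S.A ^ (t - 1 - s) * S.B) *ᵥ (w s ω).ofLp := by
    induction t with
    | zero => simp [stateTraj]
    | succ t ih =>
      rw [Finset.sum_range_succ]
      change S.A *ᵥ (stateTraj S w t ω).ofLp + S.B *ᵥ (w t ω).ofLp = _
      rw [ih, Matrix.mulVec_sum]
      simp only [add_tsub_cancel_right, tsub_self, pow_zero, Matrix.one_mul]
      congr 1
      refine Finset.sum_congr rfl fun s hs => ?_
      have hs' := Finset.mem_range.1 hs
      rw [Matrix.mulVec_mulVec, ← Matrix.mul_assoc, ← pow_succ',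
        show t - 1 - s + 1 = t - s by omega]
  rw [h, ← Fin.sum_univ_eq_sum_range fun s => (S.A ^ (t - 1 - s) * S.B) *ᵥ (w s ω).ofLp]
  ext i
  simp [LinSys.convolution, Matrix.mulVec, dotProduct, Fintype.sum_prod_type]

variable {Ω : Type*} [MeasurableSpace Ω] {P : Measure Ω}

theorem memLp_stateTraj (S : LinSys X W Z) {w : ℕ → Ω → EuclideanSpace ℝ W}
    (hw : ∀ t, MemLp (w t) 2 P) (t : ℕ) (i : X) : MemLp (fun ω => stateTraj S w t ω i) 2 P := by
  classical
  simp only [stateTraj_eq_mulVec]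
  exact memLp_mulVec _ (fun p : Fin t × W => (hw p.1).eval_piLp p.2) i

/-- The constant is chosen before `w` and `t`: it is the squared `ℓ¹` bound of the impulse response
times `c`. -/
theorem integral_stateTraj_sq_le [DecidableEq X] {S : LinSys X W Z} (hS : IsStable S.A) {c : ℝ}
    (hc0 : 0 ≤ c) : ∃ c' : ℝ, ∀ w : ℕ → Ω → EuclideanSpace ℝ W, (∀ t, MemLp (w t) 2 P) →
      (∀ t i, ∫ ω, w t ω i ^ 2 ∂P ≤ c) → ∀ t i, ∫ ω, stateTraj S w t ω i ^ 2 ∂P ≤ c' := by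
  obtain ⟨q, hq⟩ := hS.exists_sum_abs_pow_mul_le S.B
  refine ⟨q ^ 2 * c, fun w hw hc t i => ?_⟩
  simp only [stateTraj_eq_mulVec]
  refine integral_mulVec_sq_le _ (fun p : Fin t × W => (hw p.1).eval_piLp p.2) hc0
    (fun p : Fin t × W => hc p.1 p.2) ?_
  rw [Fintype.sum_prod_type]
  exact hq t i

/-- Causality: the state at time `t` is a linear combination of the disturbances at times `s < t`
only. -/
theorem integral_stateTraj_mul_eq_zero [DecidableEq X] (S : LinSys X W Z)
    {w : ℕ → Ω → EuclideanSpace ℝ W} (hw : ∀ t, MemLp (w t) 2 P) {t : ℕ} {g : Ω → ℝ}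
    (hg : MemLp g 2 P) (h : ∀ s < t, ∀ j, ∫ ω, w s ω j * g ω ∂P = 0) (i : X) :
    ∫ ω, stateTraj S w t ω i * g ω ∂P = 0 := by
  simp only [stateTraj_eq_mulVec]
  rw [integral_mulVec_mul _ (f := fun ω (p : Fin t × W) => w p.1 ω p.2)
    (fun p : Fin t × W => (hw p.1).eval_piLp p.2) hg]
  exact Finset.sum_eq_zero fun p _ => by rw [h p.1 p.1.2, mul_zero]

end Trajectory

/-! ### The relaxation bounds the stochastic problem -/

section UpperBound

variable {X W Z : Type} [Fintype X] [DecidableEq X] [Fintype W] [Fintype Z]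
  {Ω : Type*} [MeasurableSpace Ω] {P : Measure Ω}

theorem gram_eq_secondMoment {f : Ω → EuclideanSpace ℝ W} (hf : AEMeasurable f P) :
    gram P (fun ω => (f ω).ofLp) = secondMoment (P.map f) := by
  ext i j
  rw [gram_apply, secondMoment, Matrix.of_apply, integral_map hf (by fun_prop)]

theorem integral_mul_eq_zero_of_indepFun [IsFiniteMeasure P] {ι κ : Type*} [Fintype ι] [Fintype κ]
    {f : Ω → EuclideanSpace ℝ ι} {g : Ω → EuclideanSpace ℝ κ} (hf : MemLp f 2 P)
    (hg : MemLp g 2 P) (hfg : IndepFun f g P) (hg0 : ∫ ω, g ω ∂P = 0) (i : ι) (j : κ) :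
    ∫ ω, f ω i * g ω j ∂P = 0 := by
  have h : IndepFun (fun ω => f ω i) (fun ω => g ω j) P :=
    hfg.comp (φ := fun v : EuclideanSpace ℝ ι => v i) (ψ := fun v : EuclideanSpace ℝ κ => v j)
      (by fun_prop) (by fun_prop)
  have hj : ∫ ω, g ω j ∂P = 0 := by
    rw [← eval_integral_piLp fun j => (hg.eval_piLp j).integrable (by norm_num), hg0]
    rfl
  rw [h.integral_fun_mul_eq_mul_integral (hf.eval_piLp i).1 (hg.eval_piLp j).1, hj, mul_zero]

/-- The law of `ŵ(t)` does not depend on `t`, and `w(t)` stays within `L²`-distance `|γ|` of it. -/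
theorem WorstCaseFeasible.exists_integral_sq_le {k : DisturbanceKind} {γ : ℝ}
    {Pnom : Measure (EuclideanSpace ℝ W)} {w what : ℕ → Ω → EuclideanSpace ℝ W}
    (h : WorstCaseFeasible k P γ Pnom w what) :
    ∃ c : ℝ, 0 ≤ c ∧ ∀ t i, ∫ ω, w t ω i ^ 2 ∂P ≤ c ∧ ∫ ω, what t ω i ^ 2 ∂P ≤ c := by
  set b := (secondMoment Pnom).trace with hb
  have h1 : ∀ t i, ∫ ω, what t ω i ^ 2 ∂P ≤ b := by
    intro t i
    rw [hb, ← h.law_what t, ← gram_eq_secondMoment (h.memLp_what t).1.aemeasurable]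
    simp_rw [sq]
    exact Finset.single_le_sum (f := fun i => gram P (fun ω => (what t ω).ofLp) i i)
      (fun i _ => integral_nonneg fun ω => mul_self_nonneg _) (Finset.mem_univ i)
  refine ⟨2 * γ ^ 2 + 2 * |b|, by positivity, fun t i => ⟨?_, ?_⟩⟩
  · have hi1 : Integrable (fun ω => ‖w t ω - what t ω‖ ^ 2) P :=
      ((h.memLp_w t).sub (h.memLp_what t)).integrable_norm_pow (by norm_num)
    have hi2 := ((h.memLp_what t).eval_piLp i).integrable_sq
    calc ∫ ω, w t ω i ^ 2 ∂P ≤ ∫ ω, (2 * ‖w t ω - what t ω‖ ^ 2 + 2 * what t ω i ^ 2) ∂P := by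
          refine integral_mono ((h.memLp_w t).eval_piLp i).integrable_sq
            ((hi1.const_mul 2).add (hi2.const_mul 2)) fun ω => ?_
          have h2 : (w t ω i - what t ω i) ^ 2 ≤ ‖w t ω - what t ω‖ ^ 2 := by
            rw [EuclideanSpace.real_norm_sq_eq]
            exact Finset.single_le_sum (f := fun i => (w t ω - what t ω) i ^ 2)
              (fun i _ => sq_nonneg _) (Finset.mem_univ i)
          change w t ω i ^ 2 ≤ 2 * ‖w t ω - what t ω‖ ^ 2 + 2 * what t ω i ^ 2
          -- With `a = w` and `b = ŵ`: `2(a - b)² + 2b² - a² = (a - 2b)²`.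
          nlinarith [sq_nonneg (w t ω i - 2 * what t ω i)]
      _ = 2 * ∫ ω, ‖w t ω - what t ω‖ ^ 2 ∂P + 2 * ∫ ω, what t ω i ^ 2 ∂P := by
          rw [integral_add (hi1.const_mul 2) (hi2.const_mul 2), integral_const_mul,
            integral_const_mul]
      _ ≤ 2 * γ ^ 2 + 2 * |b| := by linarith [h.dist_le t, h1 t i, le_abs_self b]
  · linarith [h1 t i, le_abs_self b, abs_nonneg b, sq_nonneg γ]

/-- Every cost level reached infinitely often along a feasible disturbance is reached by a
feasible moment matrix. -/
theorem WorstCaseFeasible.exists_momentFeasible [DecidableEq W] [IsProbabilityMeasure P]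
    {S : LinSys X W Z}
    (hS : IsStable S.A) {k : DisturbanceKind} {γ : ℝ} {Pnom : Measure (EuclideanSpace ℝ W)}
    {w what : ℕ → Ω → EuclideanSpace ℝ W} (h : WorstCaseFeasible k P γ Pnom w what) {a : EReal}
    (ha : ∃ᶠ T : ℕ in atTop, a ≤ (((1 / (T : ℝ)) *
      ∑ t ∈ Finset.range T, ∫ ω, ‖outputTraj S w t ω‖ ^ 2 ∂P : ℝ) : EReal)) :
    ∃ M, MomentFeasible S k γ (secondMoment Pnom) M ∧
      a ≤ (((S.rowCD * M * S.rowCDᵀ).trace : ℝ) : EReal) := by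
  obtain ⟨c₁, hc₁, hc⟩ := h.exists_integral_sq_le
  obtain ⟨c₂, hc₂⟩ := integral_stateTraj_sq_le (P := P) hS hc₁
  have hx := hc₂ w h.memLp_w fun t i => (hc t i).1
  have hχ := memLp_stateTraj S h.memLp_w
  have hw := fun t i => (h.memLp_w t).eval_piLp i
  have hwhat := fun t i => (h.memLp_what t).eval_piLp i
  -- The state depends on `w(s)` with `s < t`, each independent of the centered `w(t)`.
  have hk : k = .ind → ∀ t i j, ∫ ω, stateTraj S w t ω i * w t ω j ∂P = 0 := by
    rintro rfl t i j
    obtain ⟨hind, hmean⟩ := h.admits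
    refine integral_stateTraj_mul_eq_zero S h.memLp_w (hw t j) (fun s hs l => ?_) i
    exact integral_mul_eq_zero_of_indepFun (h.memLp_w s) (h.memLp_w t) (hind.indepFun hs.ne)
      (hmean t) l j
  choose N hNc hmem hpsd hsel hnext hcost hdist hnom using fun t =>
    exists_momentMatrix S k (hχ t) (hw t) (hwhat t) (fun hk' => hk hk' t) (c := max c₁ c₂)
      (hc₁.trans (le_max_left _ _)) (fun i => (hx t i).trans (le_max_right _ _))
      (fun i => (hc t i).1.trans (le_max_left _ _)) (fun i => (hc t i).2.trans (le_max_left _ _))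
  refine exists_momentFeasible_of_averages hNc
    (fun t => abs_gram_le (hχ t) fun i => (hx t i).trans (le_max_right _ _)) hmem hsel hnext
    (fun t => ?_) (fun t => ?_) hpsd ?_
  · rw [hdist, trace_gram_sumElim_mul_difference (hw t) (hwhat t)]
    exact h.dist_le t
  · rw [hnom, gram_eq_secondMoment (h.memLp_what t).1.aemeasurable, h.law_what]
  · refine ha.mono fun T hT => hT.trans (le_of_eq ?_)
    congr 2
    refine Finset.sum_congr rfl fun t _ => ?_
    have hz : ∀ i, MemLp (fun ω => (S.C *ᵥ (stateTraj S w t ω).ofLp + S.D *ᵥ (w t ω).ofLp) i) 2 P :=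
      fun i => (memLp_mulVec S.C (hχ t) i).add (memLp_mulVec S.D (hw t) i)
    rw [hcost, trace_gram hz]
    rfl

end UpperBound

/-! ### Regression factorization of a moment matrix -/

/-- Least squares: the residual is orthogonal to the range of the regressors. -/
theorem exists_eq_mul_transpose_add {N X D : Type*} [Fintype N] [Fintype X]
    (L₁ : Matrix N X ℝ) (L₂ : Matrix N D ℝ) :
    ∃ (K : Matrix D X ℝ) (R : Matrix N D ℝ), L₂ = L₁ * Kᵀ + R ∧ L₁ᵀ * R = 0 := by
  classical
  have h : ∀ j, ∃ (k : X → ℝ) (r : N → ℝ), L₂ᵀ j = L₁ *ᵥ k + r ∧ L₁ᵀ *ᵥ r = 0 := by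
    intro j
    obtain ⟨y, ⟨k, rfl⟩, z, hz, h⟩ := Submodule.exists_add_mem_mem_orthogonal
      (K := LinearMap.range (Matrix.toEuclideanLin L₁)) (WithLp.toLp 2 (L₂ᵀ j))
    refine ⟨k.ofLp, z.ofLp, ?_, ?_⟩
    · have := congrArg WithLp.ofLp h
      simpa using this
    · ext i
      have := (Submodule.mem_orthogonal _ _).1 hz _
        (LinearMap.mem_range_self (Matrix.toEuclideanLin L₁) (EuclideanSpace.single i 1))
      simpa [Matrix.mulVec, dotProduct, PiLp.inner_apply, Pi.single_apply, mul_comm] using this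
  choose k r hL hr using h
  refine ⟨Matrix.of k, (Matrix.of r)ᵀ, ?_, ?_⟩
  · ext n j
    simpa [Matrix.mul_apply, Matrix.mulVec, dotProduct] using congrFun (hL j) n
  · ext i j
    simpa [Matrix.mul_apply, Matrix.mulVec, dotProduct] using congrFun (hr j) i

/-- The matrix of the map `(x, e) ↦ (x, K x + Rᵀ e)`. -/
def feedbackMap {N X D : Type*} [DecidableEq X] (K : Matrix D X ℝ) (R : Matrix N D ℝ) :
    Matrix (X ⊕ D) (X ⊕ N) ℝ :=
  Matrix.fromBlocks 1 0 K Rᵀ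

theorem feedbackMap_mulVec {N X D : Type*} [Fintype N] [Fintype X] [DecidableEq X]
    (K : Matrix D X ℝ) (R : Matrix N D ℝ) (x : X → ℝ) (e : N → ℝ) :
    feedbackMap K R *ᵥ Sum.elim x e = Sum.elim x (K *ᵥ x + Rᵀ *ᵥ e) := by
  simp [feedbackMap, Matrix.fromBlocks_mulVec]

theorem feedbackMap_mul_mul_transpose {N X D : Type*} [Fintype N] [DecidableEq N] [Fintype X]
    [DecidableEq X] (K : Matrix D X ℝ) (R : Matrix N D ℝ) (Q : Matrix X X ℝ) :
    feedbackMap K R * Matrix.fromBlocks Q 0 0 (1 : Matrix N N ℝ) * (feedbackMap K R)ᵀ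
      = Matrix.fromBlocks Q (Q * Kᵀ) (K * Q) (K * Q * Kᵀ + Rᵀ * R) := by
  rw [feedbackMap, Matrix.fromBlocks_transpose, Matrix.fromBlocks_multiply,
    Matrix.fromBlocks_multiply]
  simp

open scoped MatrixOrder in
/-- A positive semidefinite block matrix is the second moment matrix of `(x, K x + Rᵀ e)` with
`x = L₁ᵀ e'` and uncorrelated standardized `e'`, `e`; one can take `K = 0` if the off-diagonal
blocks vanish. -/
theorem exists_regression {X D : Type*} [Fintype X] [DecidableEq X] [Fintype D] [DecidableEq D]
    {M : Matrix (X ⊕ D) (X ⊕ D) ℝ} (hM : M.PosSemidef) :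
    ∃ (L : Matrix (X ⊕ D) X ℝ) (K : Matrix D X ℝ) (R : Matrix (X ⊕ D) D ℝ),
      M = feedbackMap K R * Matrix.fromBlocks (Lᵀ * L) 0 0 (1 : Matrix (X ⊕ D) (X ⊕ D) ℝ) *
        (feedbackMap K R)ᵀ ∧
      (M.toBlocks₁₂ = 0 → K = 0) := by
  -- The two column blocks of a square root of `M` play the roles of `x` and `d`; regressing the
  -- second on the first avoids inverting a possibly singular block.
  obtain ⟨B, hB⟩ : ∃ B : Matrix (X ⊕ D) (X ⊕ D) ℝ, M = Bᵀ * B := by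
    have h := CFC.sqrt_mul_sqrt_self M hM.nonneg
    have hT : (CFC.sqrt M)ᵀ = CFC.sqrt M := 
      (Matrix.nonneg_iff_posSemidef.1 (CFC.sqrt_nonneg M)).1
    exact ⟨CFC.sqrt M, by rw [hT, h]⟩
  set L₁ := B.toCols₁
  set L₂ := B.toCols₂
  have hM' : M = Matrix.fromBlocks (L₁ᵀ * L₁) (L₁ᵀ * L₂) (L₂ᵀ * L₁) (L₂ᵀ * L₂) := by
    rw [hB, ← Matrix.fromCols_toCols B, Matrix.transpose_fromCols, Matrix.fromRows_mul_fromCols]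
  -- The regression coefficient is not unique if `L₁ᵀ * L₁` is singular, so `K = 0` has to be chosen
  -- explicitly.
  by_cases h0 : M.toBlocks₁₂ = 0
  · refine ⟨L₁, 0, L₂, ?_, fun _ => rfl⟩
    have h1 : L₁ᵀ * L₂ = 0 := by rw [← h0, hM', Matrix.toBlocks_fromBlocks₁₂]
    have h2 : L₂ᵀ * L₁ = 0 := by
      rw [← Matrix.transpose_transpose L₁, ← Matrix.transpose_mul, h1, Matrix.transpose_zero]
    rw [feedbackMap_mul_mul_transpose, hM', h1, h2]
    simp
  · obtain ⟨K, R, hL, hR⟩ := exists_eq_mul_transpose_add L₁ L₂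
    refine ⟨L₁, K, R, ?_, fun h => absurd h h0⟩
    have hR' : Rᵀ * L₁ = 0 := by
      rw [← Matrix.transpose_transpose L₁, ← Matrix.transpose_mul, hR, Matrix.transpose_zero]
    have h1 : L₁ᵀ * L₂ = L₁ᵀ * L₁ * Kᵀ := by
      rw [hL, Matrix.mul_add, hR, add_zero, Matrix.mul_assoc]
    have h2 : L₂ᵀ * L₁ = K * (L₁ᵀ * L₁) := by
      rw [hL, Matrix.transpose_add, Matrix.add_mul, hR', add_zero, Matrix.transpose_mul,
        Matrix.transpose_transpose, Matrix.mul_assoc]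
    have h3 : L₂ᵀ * L₂ = K * (L₁ᵀ * L₁) * Kᵀ + Rᵀ * R := by
      conv_lhs => rw [hL]
      rw [Matrix.transpose_add, Matrix.add_mul, Matrix.mul_add, Matrix.mul_add,
        ← Matrix.mul_assoc Rᵀ, hR', Matrix.zero_mul, zero_add, Matrix.transpose_mul,
        Matrix.transpose_transpose, Matrix.mul_assoc K L₁ᵀ R, hR, Matrix.mul_zero, add_zero]
      simp only [Matrix.mul_assoc]
    rw [feedbackMap_mul_mul_transpose, hM', h1, h2, h3]

/-! ### Centered Gaussian measures and their second moments -/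

theorem covarianceBilin_eq_dotProduct {W : Type} [Fintype W] (ρ : Measure (EuclideanSpace ℝ W))
    [IsGaussian ρ] (hρ : ∫ v, v ∂ρ = 0) (x y : EuclideanSpace ℝ W) :
    covarianceBilin ρ x y = x.ofLp ⬝ᵥ secondMoment ρ *ᵥ y.ofLp := by
  have hid : MemLp id 2 ρ := IsGaussian.memLp_two_id
  have hρ' : ∫ v, id v ∂ρ = 0 := hρ
  have hi := fun i => hid.eval_piLp i
  have hs : secondMoment ρ *ᵥ y.ofLp = fun i => ∫ v, v i * inner ℝ y v ∂ρ := by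
    ext i
    simp_rw [mul_comm _ (inner ℝ y _)]
    have := integral_mulVec_mul (Matrix.of fun _ : Unit => y.ofLp) hi (hi i) ()
    simp only [Matrix.mulVec, dotProduct, Matrix.of_apply, id_eq] at this
    simp only [PiLp.inner_apply, RCLike.inner_apply, conj_trivial, secondMoment, Matrix.mulVec,
      dotProduct, Matrix.of_apply]
    simp_rw [mul_comm _ (y _), this]
    simp_rw [mul_comm (y _), mul_comm (_ : ℝ) (_ : ℝ)]
  have hy : MemLp (fun v => inner ℝ y v) 2 ρ := hid.const_inner y
  rw [covarianceBilin_apply hid, hρ', hs]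
  have := integral_mulVec_mul (Matrix.of fun _ : Unit => x.ofLp) hi hy ()
  simp only [Matrix.mulVec, dotProduct, Matrix.of_apply, id_eq] at this
  simp only [dotProduct, sub_zero]
  rw [← this]
  simp [PiLp.inner_apply, mul_comm]

/-- A centered Gaussian measure is determined by its second moments. -/
theorem eq_of_secondMoment_eq {W : Type} [Fintype W] {μ ν : Measure (EuclideanSpace ℝ W)}
    [IsGaussian μ] [IsGaussian ν] (hμ : ∫ v, v ∂μ = 0) (hν : ∫ v, v ∂ν = 0)
    (h : secondMoment μ = secondMoment ν) : μ = ν := by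
  refine IsGaussian.ext (hμ.trans hν.symm) ?_
  ext x y
  rw [covarianceBilin_eq_dotProduct μ hμ, covarianceBilin_eq_dotProduct ν hν, h]

theorem secondMoment_stdGaussian {N : Type} [Fintype N] [DecidableEq N] :
    secondMoment (stdGaussian (EuclideanSpace ℝ N)) = 1 := by
  ext i j
  have h := covarianceBilin_eq_dotProduct (stdGaussian (EuclideanSpace ℝ N))
    integral_id_stdGaussian (EuclideanSpace.single i 1) (EuclideanSpace.single j 1)
  rw [covarianceBilin_stdGaussian, innerSL_apply_apply, EuclideanSpace.inner_single_left] at h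
  have h' : (if i = j then (1 : ℝ) else 0) =
      secondMoment (stdGaussian (EuclideanSpace ℝ N)) i j := by
    simpa [Pi.single_apply] using h
  rw [← h', Matrix.one_apply]

theorem exists_mulVec_sumElim_eq_sum {X N Y Ω : Type*} [Fintype X] [Fintype N] {x : Ω → X → ℝ}
    {e : ℕ → Ω → EuclideanSpace ℝ N} {F : ℕ → Matrix X N ℝ} {t : ℕ}
    (hF : ∀ ω, x ω = ∑ s ∈ Finset.range t, F s *ᵥ (e s ω).ofLp) (G : Matrix Y (X ⊕ N) ℝ) :
    ∃ F' : ℕ → Matrix Y N ℝ, ∀ ω, G *ᵥ Sum.elim (x ω) (e t ω).ofLp =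
      ∑ s ∈ Finset.range (t + 1), F' s *ᵥ (e s ω).ofLp := by
  refine ⟨fun s => if s = t then G.toCols₂ else G.toCols₁ * F s, fun ω => ?_⟩
  conv_lhs =>
    rw [hF, ← Matrix.fromCols_toCols G, Matrix.fromCols_mulVec_sumElim, Matrix.mulVec_sum]
  rw [Finset.sum_range_succ _ t]
  beta_reduce
  rw [if_pos rfl]
  congr 1
  refine Finset.sum_congr rfl fun s hs => ?_
  rw [if_neg (Finset.mem_range.1 hs).ne, Matrix.mulVec_mulVec]

/-! ### The stationary Gaussian feedback process -/

section Stationary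

variable {X W Z N : Type} [Fintype X] [DecidableEq X] [Fintype W] [Fintype N]

/-- The state process `x(t+1) = 𝒜 x(t) + ℬ w(t)` with `x(0) = Lᵀ e(0)` under the feedback
disturbance `(w(t), ŵ(t)) = K x(t) + Rᵀ e(t+1)`. -/
def feedbackState (S : LinSys X W Z) (L : Matrix N X ℝ) (K : Matrix (W ⊕ W) X ℝ)
    (R : Matrix N (W ⊕ W) ℝ) {Ω : Type*} (e : ℕ → Ω → EuclideanSpace ℝ N) : ℕ → Ω → X → ℝ
  | 0 => fun ω => Lᵀ *ᵥ (e 0 ω).ofLp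
  | t + 1 => fun ω => (S.rowAB * feedbackMap K R) *ᵥ
      Sum.elim (feedbackState S L K R e t ω) (e (t + 1) ω).ofLp

/-- The vector `(x(t), (w(t), ŵ(t)))` of the feedback disturbance. -/
def feedbackSignal (S : LinSys X W Z) (L : Matrix N X ℝ) (K : Matrix (W ⊕ W) X ℝ)
    (R : Matrix N (W ⊕ W) ℝ) {Ω : Type*} (e : ℕ → Ω → EuclideanSpace ℝ N) (t : ℕ) (ω : Ω) :
    X ⊕ (W ⊕ W) → ℝ :=
  feedbackMap K R *ᵥ Sum.elim (feedbackState S L K R e t ω) (e (t + 1) ω).ofLp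

variable {S : LinSys X W Z} {L : Matrix N X ℝ} {K : Matrix (W ⊕ W) X ℝ}
  {R : Matrix N (W ⊕ W) ℝ}

/-- The disturbance `w(t)` under feedback. -/
noncomputable def feedbackDist (S : LinSys X W Z) (L : Matrix N X ℝ) (K : Matrix (W ⊕ W) X ℝ)
    (R : Matrix N (W ⊕ W) ℝ) {Ω : Type*} (e : ℕ → Ω → EuclideanSpace ℝ N) (t : ℕ) (ω : Ω) :
    EuclideanSpace ℝ W :=
  WithLp.toLp 2 fun i => feedbackSignal S L K R e t ω (.inr (.inl i))

/-- The nominal disturbance `ŵ(t)` under feedback. -/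
noncomputable def feedbackNom (S : LinSys X W Z) (L : Matrix N X ℝ) (K : Matrix (W ⊕ W) X ℝ)
    (R : Matrix N (W ⊕ W) ℝ) {Ω : Type*} (e : ℕ → Ω → EuclideanSpace ℝ N) (t : ℕ) (ω : Ω) :
    EuclideanSpace ℝ W :=
  WithLp.toLp 2 fun i => feedbackSignal S L K R e t ω (.inr (.inr i))

theorem feedbackSignal_eq_sumElim {Ω : Type*} (e : ℕ → Ω → EuclideanSpace ℝ N) (t : ℕ) (ω : Ω) :
    feedbackSignal S L K R e t ω = Sum.elim (feedbackState S L K R e t ω)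
      (Sum.elim (feedbackDist S L K R e t ω).ofLp (feedbackNom S L K R e t ω).ofLp) := by
  ext (i | i | i)
  · rw [feedbackSignal, feedbackMap_mulVec]
    rfl
  · rfl
  · rfl

theorem feedbackState_succ {Ω : Type*} (e : ℕ → Ω → EuclideanSpace ℝ N) (t : ℕ) (ω : Ω) :
    feedbackState S L K R e (t + 1) ω = S.A *ᵥ feedbackState S L K R e t ω +
      S.B *ᵥ (feedbackDist S L K R e t ω).ofLp := by
  rw [← LinSys.rowAB_mulVec _ _ _ (feedbackNom S L K R e t ω).ofLp, ← feedbackSignal_eq_sumElim,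
    feedbackSignal, Matrix.mulVec_mulVec]
  rfl

/-- By linearity, two trajectories under the same disturbance differ by the free response to the
initial state. -/
theorem stateTraj_feedbackDist {Ω : Type*} (e : ℕ → Ω → EuclideanSpace ℝ N) (t : ℕ) (ω : Ω) :
    (stateTraj S (feedbackDist S L K R e) t ω).ofLp = feedbackState S L K R e t ω -
      S.A ^ t *ᵥ feedbackState S L K R e 0 ω := by
  induction t with
  | zero => simp [stateTraj]
  | succ t ih =>
    change S.A *ᵥ (stateTraj S (feedbackDist S L K R e) t ω).ofLp
      + S.B *ᵥ (feedbackDist S L K R e t ω).ofLp = _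
    rw [ih, feedbackState_succ, Matrix.mulVec_sub, Matrix.mulVec_mulVec, ← pow_succ']
    abel

theorem exists_feedbackState_eq_sum {Ω : Type*} (e : ℕ → Ω → EuclideanSpace ℝ N) (t : ℕ) :
    ∃ F : ℕ → Matrix X N ℝ, ∀ ω, feedbackState S L K R e t ω =
      ∑ s ∈ Finset.range (t + 1), F s *ᵥ (e s ω).ofLp := by
  induction t with
  | zero => exact ⟨fun _ => Lᵀ, fun ω => by simp [feedbackState]⟩
  | succ t ih =>
    obtain ⟨F, hF⟩ := ih
    exact exists_mulVec_sumElim_eq_sum hF _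

/-- Independence is essential: it makes the summands jointly Gaussian. -/
theorem hasGaussianLaw_sum_mulVec {Y : Type*} [Fintype Y] {Ω : Type*} [MeasurableSpace Ω]
    {P : Measure Ω} {e : ℕ → Ω → EuclideanSpace ℝ N} (he : iIndepFun e P)
    (hG : ∀ t, HasGaussianLaw (e t) P) (F : ℕ → Matrix Y N ℝ) (t : ℕ) :
    HasGaussianLaw (fun ω => (WithLp.toLp 2 (∑ s ∈ Finset.range t, F s *ᵥ (e s ω).ofLp) :
      EuclideanSpace ℝ Y)) P := by
  classical
  let Φ : ℕ → EuclideanSpace ℝ N →L[ℝ] EuclideanSpace ℝ Y := fun s =>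
    (Matrix.toEuclideanLin (F s)).toContinuousLinearMap
  have h := iIndepFun.hasGaussianLaw_fun_sum (P := P)
    (X := fun (s : Fin t) ω => Φ s (e s ω)) (fun s => (hG s).map_fun (Φ s))
    ((he.precomp (g := fun s : Fin t => (s : ℕ)) Fin.val_injective).comp (fun s => Φ s)
      fun s => (Φ s).continuous.measurable)
  have heq : (fun ω => (WithLp.toLp 2 (∑ s ∈ Finset.range t, F s *ᵥ (e s ω).ofLp) :
      EuclideanSpace ℝ Y)) = fun ω => ∑ s : Fin t, Φ s (e s ω) := by
    ext1 ω
    rw [Fin.sum_univ_eq_sum_range fun s => Φ s (e s ω), WithLp.toLp_sum]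
    rfl
  rw [heq]
  exact h

variable {Ω : Type*} [MeasurableSpace Ω] {P : Measure Ω} {e : ℕ → Ω → EuclideanSpace ℝ N}

theorem memLp_feedbackState (he : ∀ t, MemLp (e t) 2 P) (t : ℕ) (i : X) :
    MemLp (fun ω => feedbackState S L K R e t ω i) 2 P := by
  induction t generalizing i with
  | zero => exact memLp_mulVec _ (fun j => (he 0).eval_piLp j) i
  | succ t ih => exact memLp_mulVec _ (memLp_sumElim ih fun j => (he (t + 1)).eval_piLp j) i

theorem memLp_feedbackSignal (he : ∀ t, MemLp (e t) 2 P) (t : ℕ) (i : X ⊕ (W ⊕ W)) :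
    MemLp (fun ω => feedbackSignal S L K R e t ω i) 2 P :=
  memLp_mulVec _ (memLp_sumElim (memLp_feedbackState he t) fun j => (he (t + 1)).eval_piLp j) i

/-- The state at time `t` involves only `e(0), …, e(t)`. Used with `g` a coordinate of `e(t+1)` and,
for the mean, with `g = 1`. -/
theorem integral_feedbackState_mul_eq_zero (he : ∀ t, MemLp (e t) 2 P) {g : Ω → ℝ}
    (hg : MemLp g 2 P) {t : ℕ} (h : ∀ s ≤ t, ∀ j, ∫ ω, e s ω j * g ω ∂P = 0) (i : X) :
    ∫ ω, feedbackState S L K R e t ω i * g ω ∂P = 0 := by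
  induction t generalizing i with
  | zero =>
    simp only [feedbackState]
    rw [integral_mulVec_mul _ (fun j => (he 0).eval_piLp j) hg]
    exact Finset.sum_eq_zero fun j _ => by rw [h 0 le_rfl j, mul_zero]
  | succ t ih =>
    simp only [feedbackState]
    rw [integral_mulVec_mul _ (memLp_sumElim (memLp_feedbackState he t)
      fun j => (he (t + 1)).eval_piLp j) hg]
    refine Finset.sum_eq_zero fun j _ => mul_eq_zero_of_right _ ?_
    rcases j with j | j
    · exact ih (fun s hs => h s (hs.trans t.le_succ)) j
    · exact h (t + 1) le_rfl j

theorem integral_feedbackSignal [IsFiniteMeasure P] (he : ∀ t, MemLp (e t) 2 P)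
    (h0 : ∀ t j, ∫ ω, e t ω j ∂P = 0) (t : ℕ) (i : X ⊕ (W ⊕ W)) :
    ∫ ω, feedbackSignal S L K R e t ω i ∂P = 0 := by
  have h1 : MemLp (fun _ : Ω => (1 : ℝ)) 2 P := memLp_const 1
  have h := integral_mulVec_mul (feedbackMap K R) (memLp_sumElim
    (memLp_feedbackState (S := S) (L := L) (K := K) (R := R) he t)
    fun j => (he (t + 1)).eval_piLp j) h1 i
  simp only [mul_one] at h
  simp only [feedbackSignal]
  rw [h]
  refine Finset.sum_eq_zero fun j _ => mul_eq_zero_of_right _ ?_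
  rcases j with j | j
  · simpa using integral_feedbackState_mul_eq_zero (S := S) (L := L) (K := K) (R := R) he h1
      (t := t) (fun s _ l => by simpa using h0 s l) j
  · exact h0 (t + 1) j

/-- If `x(t)` has moments `Lᵀ * L`, the fresh noise `e(t+1)` completes them to `M`; stationarity of
`M` then returns `Lᵀ * L` for `x(t+1)`. The choice `x(0) = Lᵀ e(0)` starts the induction. -/
theorem gram_feedbackSignal [DecidableEq N] {M : Matrix (X ⊕ (W ⊕ W)) (X ⊕ (W ⊕ W)) ℝ}
    (he : ∀ t, MemLp (e t) 2 P) (he1 : ∀ t, gram P (fun ω => (e t ω).ofLp) = 1)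
    (he0 : ∀ s t, s ≠ t → ∀ i j, ∫ ω, e s ω i * e t ω j ∂P = 0)
    (hM : M = feedbackMap K R * Matrix.fromBlocks (Lᵀ * L) 0 0 (1 : Matrix N N ℝ) *
      (feedbackMap K R)ᵀ)
    (hstat : selState X W * M * (selState X W)ᵀ = S.rowAB * M * S.rowABᵀ) (t : ℕ) :
    gram P (feedbackSignal S L K R e t) = M := by
  have hsig : ∀ t, gram P (feedbackState S L K R e t) = Lᵀ * L →
      gram P (feedbackSignal S L K R e t) = M := by
    intro t ht
    have h1 := memLp_sumElim (memLp_feedbackState (S := S) (L := L) (K := K) (R := R) he t)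
      fun j => (he (t + 1)).eval_piLp j
    have h2 := gram_mulVec (feedbackMap K R) h1
    rw [gram_sumElim, ht, he1, ← hM] at h2
    · exact h2
    · intro i j
      exact integral_feedbackState_mul_eq_zero he ((he (t + 1)).eval_piLp j)
        (fun s hs l => he0 s (t + 1) (by omega) l j) i
  refine hsig t ?_
  induction t with
  | zero =>
    have h := gram_mulVec Lᵀ fun j => (he 0).eval_piLp j
    rw [he1, Matrix.mul_one, Matrix.transpose_transpose] at h
    exact h
  | succ t ih =>
    have h : feedbackState S L K R e (t + 1)
        = fun ω => S.rowAB *ᵥ feedbackSignal S L K R e t ω := by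
      ext1 ω
      rw [feedbackSignal, Matrix.mulVec_mulVec]
      rfl
    rw [h, gram_mulVec _ (memLp_feedbackSignal he t), hsig t ih, ← hstat, hM,
      feedbackMap_mul_mul_transpose, selState, Matrix.fromCols_mul_fromBlocks,
      Matrix.transpose_fromCols, Matrix.fromCols_mul_fromRows]
    simp

theorem hasGaussianLaw_feedbackNom (he : iIndepFun e P) (hG : ∀ t, HasGaussianLaw (e t) P)
    (t : ℕ) : HasGaussianLaw (feedbackNom S L K R e t) P := by
  obtain ⟨F, hF⟩ := exists_feedbackState_eq_sum (S := S) (L := L) (K := K) (R := R) e t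
  obtain ⟨F', hF'⟩ := exists_mulVec_sumElim_eq_sum hF
    ((feedbackMap K R).submatrix (fun i : W => .inr (.inr i)) id)
  -- The signal at time `t` uses `e(0), …, e(t+1)`, hence `t + 2` summands.
  have h := hasGaussianLaw_sum_mulVec he hG F' (t + 1 + 1)
  simp only [← hF'] at h
  exact h

end Stationary

/-! ### Realizing a feasible moment matrix -/

theorem outputTraj_feedbackDist {X W Z N : Type} [Fintype X] [DecidableEq X] [Fintype W] [Fintype N]
    {S : LinSys X W Z} {L : Matrix N X ℝ} {K : Matrix (W ⊕ W) X ℝ} {R : Matrix N (W ⊕ W) ℝ}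
    {Ω : Type*} {e : ℕ → Ω → EuclideanSpace ℝ N} (t : ℕ) (ω : Ω) :
    (outputTraj S (feedbackDist S L K R e) t ω).ofLp = S.rowCD *ᵥ feedbackSignal S L K R e t ω -
      (S.C * S.A ^ t) *ᵥ feedbackState S L K R e 0 ω := by
  rw [feedbackSignal_eq_sumElim, LinSys.rowCD_mulVec]
  change S.C *ᵥ (stateTraj S (feedbackDist S L K R e) t ω).ofLp
      + S.D *ᵥ (feedbackDist S L K R e t ω).ofLp = _
  rw [stateTraj_feedbackDist, Matrix.mulVec_sub, Matrix.mulVec_mulVec]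
  abel

theorem averageCost_eq_of_tendsto {X W Z : Type} [Fintype X] [Fintype W] [Fintype Z]
    {S : LinSys X W Z} {Ω : Type*} [MeasurableSpace Ω] {P : Measure Ω}
    {w : ℕ → Ω → EuclideanSpace ℝ W} {c : ℝ}
    (h : Tendsto (fun t => ∫ ω, ‖outputTraj S w t ω‖ ^ 2 ∂P) atTop (𝓝 c)) :
    averageCost S P w = c := by
  refine Tendsto.limsup_eq ((continuous_coe_real_ereal.tendsto c).comp ?_)
  simpa [one_div] using h.cesaro

section LowerBound

variable {X W Z N : Type} [Fintype X] [DecidableEq X] [Fintype W] [Fintype Z] [Fintype N]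
  {S : LinSys X W Z} {L : Matrix N X ℝ} {K : Matrix (W ⊕ W) X ℝ} {R : Matrix N (W ⊕ W) ℝ}
  {Ω : Type*} [MeasurableSpace Ω] {P : Measure Ω} {e : ℕ → Ω → EuclideanSpace ℝ N}

theorem integral_sub_sq {f g : Ω → ℝ} (hf : MemLp f 2 P) (hg : MemLp g 2 P) :
    ∫ ω, (f ω - g ω) ^ 2 ∂P
      = ∫ ω, f ω * f ω ∂P - 2 * ∫ ω, g ω * f ω ∂P + ∫ ω, g ω * g ω ∂P := by
  have h1 := integrable_mul_of_memLp_two hf hf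
  have h2 := (integrable_mul_of_memLp_two hg hf).const_mul 2
  have h3 := integrable_mul_of_memLp_two hg hg
  have h4 : Integrable (fun ω => f ω * f ω - 2 * (g ω * f ω)) P := h1.sub h2
  rw [← integral_const_mul, ← integral_sub h1 h2, ← integral_add h4 h3]
  congr 1
  ext1 ω
  ring

/-- If the signal under feedback has second moments `M` at all times, then the output power
converges to that of `M`, irrespective of the initial condition. -/
theorem tendsto_integral_outputTraj_feedbackDist (hS : IsStable S.A)
    {M : Matrix (X ⊕ (W ⊕ W)) (X ⊕ (W ⊕ W)) ℝ} (he : ∀ t, MemLp (e t) 2 P)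
    (hM : ∀ t, gram P (feedbackSignal S L K R e t) = M) :
    Tendsto (fun t => ∫ ω, ‖outputTraj S (feedbackDist S L K R e) t ω‖ ^ 2 ∂P) atTop
      (𝓝 (S.rowCD * M * S.rowCDᵀ).trace) := by
  have hx := memLp_feedbackState (S := S) (L := L) (K := K) (R := R) he 0
  have hs := memLp_feedbackSignal (S := S) (L := L) (K := K) (R := R) he
  have hz := fun t => memLp_mulVec S.rowCD (hs t)
  have hd := fun t => memLp_mulVec (S.C * S.A ^ t) hx
  have hz2 : ∀ t i, ∫ ω, (S.rowCD *ᵥ feedbackSignal S L K R e t ω) i *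
      (S.rowCD *ᵥ feedbackSignal S L K R e t ω) i ∂P = (S.rowCD * M * S.rowCDᵀ) i i := by
    intro t i
    rw [← hM t, ← gram_mulVec _ (hs t)]
    rfl
  have hF : Tendsto (fun t : ℕ => S.C * S.A ^ t) atTop (𝓝 0) := by
    have h := ((by fun_prop : Continuous fun T : Matrix X X ℝ => S.C * T).tendsto 0).comp
      hS.tendsto_pow
    rw [Matrix.mul_zero] at h
    exact h
  have hF' : ∀ i j, Tendsto (fun t : ℕ => (S.C * S.A ^ t) i j) atTop (𝓝 0) := fun i j =>
    tendsto_pi_nhds.1 (tendsto_pi_nhds.1 hF i) j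
  -- The output is a signal of constant power minus a transient; the square splits into that power,
  -- a cross term and the transient's power.
  have hexp : ∀ t, ∫ ω, ‖outputTraj S (feedbackDist S L K R e) t ω‖ ^ 2 ∂P
      = ∑ i, ((S.rowCD * M * S.rowCDᵀ) i i - 2 * ∑ j, (S.C * S.A ^ t) i j *
        ∫ ω, feedbackState S L K R e 0 ω j * (S.rowCD *ᵥ feedbackSignal S L K R e t ω) i ∂P
        + ((S.C * S.A ^ t) * gram P (feedbackState S L K R e 0) * (S.C * S.A ^ t)ᵀ) i i) := by
    intro t
    simp only [EuclideanSpace.real_norm_sq_eq, outputTraj_feedbackDist, Pi.sub_apply]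
    have hi : ∀ i, Integrable (fun ω => ((S.rowCD *ᵥ feedbackSignal S L K R e t ω) i -
        ((S.C * S.A ^ t) *ᵥ feedbackState S L K R e 0 ω) i) ^ 2) P := fun i =>
      ((hz t i).sub (hd t i)).integrable_sq
    rw [integral_finsetSum _ fun i _ => hi i]
    refine Finset.sum_congr rfl fun i _ => ?_
    rw [integral_sub_sq (hz t i) (hd t i), hz2, integral_mulVec_mul _ hx (hz t i),
      ← gram_mulVec _ hx]
    rfl
  simp only [hexp, Matrix.trace, Matrix.diag]
  refine tendsto_finsetSum _ fun i _ => ?_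
  -- The correlations stay bounded in `t` because both factors have constant second moments, while
  -- `S.C * S.A ^ t` tends to zero.
  have h1 : ∀ j, Tendsto (fun t : ℕ => (S.C * S.A ^ t) i j * ∫ ω, feedbackState S L K R e 0 ω j *
      (S.rowCD *ᵥ feedbackSignal S L K R e t ω) i ∂P) atTop (𝓝 0) := by
    intro j
    refine squeeze_zero_norm (a := fun t => |(S.C * S.A ^ t) i j| *
      ((∫ ω, feedbackState S L K R e 0 ω j ^ 2 ∂P + (S.rowCD * M * S.rowCDᵀ) i i) / 2))
      (fun t => ?_) ?_
    · rw [Real.norm_eq_abs, abs_mul, ← hz2 t]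
      simp_rw [← sq ((S.rowCD *ᵥ feedbackSignal S L K R e t _) i)]
      exact mul_le_mul_of_nonneg_left (abs_integral_mul_le (hx j) (hz t i)) (abs_nonneg _)
    · simpa using (hF' i j).abs.mul_const
        ((∫ ω, feedbackState S L K R e 0 ω j ^ 2 ∂P + (S.rowCD * M * S.rowCDᵀ) i i) / 2)
  have h2 : Tendsto (fun t : ℕ => ((S.C * S.A ^ t) * gram P (feedbackState S L K R e 0) *
      (S.C * S.A ^ t)ᵀ) i i) atTop (𝓝 0) := by
    have h := ((by fun_prop : Continuous fun T : Matrix Z X ℝ =>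
      T * (gram P (feedbackState S L K R e 0) * Tᵀ)).tendsto 0).comp hF
    rw [Matrix.zero_mul] at h
    simp only [Matrix.mul_assoc (S.C * S.A ^ _)]
    exact tendsto_pi_nhds.1 (tendsto_pi_nhds.1 h i) i
  simpa using (((tendsto_finsetSum Finset.univ fun j _ => h1 j).const_mul 2).const_sub
    ((S.rowCD * M * S.rowCDᵀ) i i)).add h2

/-- Every feasible moment matrix is realized by a Gaussian disturbance process. -/
theorem MomentFeasible.exists_worstCaseFeasible [DecidableEq W] [IsProbabilityMeasure P]
    [MeasurableSpace.CountablySeparated Ω] [NullSingletonClass P] (hS : IsStable S.A)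
    {k : DisturbanceKind} {γ : ℝ} {Pnom : Measure (EuclideanSpace ℝ W)} [IsGaussian Pnom]
    (hmean : ∫ v, v ∂Pnom = 0) {M : Matrix (X ⊕ (W ⊕ W)) (X ⊕ (W ⊕ W)) ℝ}
    (hM : MomentFeasible S k γ (secondMoment Pnom) M) :
    ∃ w what : ℕ → Ω → EuclideanSpace ℝ W, WorstCaseFeasible k P γ Pnom w what ∧
      averageCost S P w = (((S.rowCD * M * S.rowCDᵀ).trace : ℝ) : EReal) := by
  obtain ⟨L, K, R, hLKR, hK⟩ := exists_regression hM.posSemidef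
  obtain ⟨e, hem, helaw, heind⟩ := exists_iIndepFun_map_eq P
    (stdGaussian (EuclideanSpace ℝ (X ⊕ (W ⊕ W))))
  have heG : ∀ t, HasGaussianLaw (e t) P := fun t => ⟨by rw [helaw]; infer_instance⟩
  have he : ∀ t, MemLp (e t) 2 P := fun t => (heG t).memLp_two
  have hemean : ∀ t, ∫ ω, e t ω ∂P = 0 := by
    intro t
    rw [← integral_map (φ := e t) (f := fun v => v) (hem t).aemeasurable (by fun_prop), helaw,
      integral_id_stdGaussian]
  have he1 : ∀ t, gram P (fun ω => (e t ω).ofLp) = 1 := by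
    intro t
    rw [gram_eq_secondMoment (hem t).aemeasurable, helaw, secondMoment_stdGaussian]
  have he0 : ∀ s t, s ≠ t → ∀ i j, ∫ ω, e s ω i * e t ω j ∂P = 0 := fun s t hst =>
    integral_mul_eq_zero_of_indepFun (he s) (he t) (heind.indepFun hst) (hemean t)
  have hgram : ∀ t, gram P (feedbackSignal S L K R e t) = M :=
    gram_feedbackSignal he he1 he0 hLKR hM.stationary
  have hsmem := memLp_feedbackSignal (S := S) (L := L) (K := K) (R := R) he
  have hwmem : ∀ t, MemLp (feedbackDist S L K R e t) 2 P := fun t =>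
    MemLp.of_eval_piLp fun i => hsmem t (.inr (.inl i))
  have hnmem : ∀ t, MemLp (feedbackNom S L K R e t) 2 P := fun t =>
    MemLp.of_eval_piLp fun i => hsmem t (.inr (.inr i))
  have hs0 := integral_feedbackSignal (S := S) (L := L) (K := K) (R := R) he fun t j => by
    rw [← eval_integral_piLp fun j => ((he t).eval_piLp j).integrable (by norm_num), hemean]
    rfl
  have hw0 : ∀ t, ∫ ω, feedbackDist S L K R e t ω ∂P = 0 := by
    intro t
    ext i
    rw [eval_integral_piLp fun j => ((hwmem t).eval_piLp j).integrable (by norm_num)]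
    exact hs0 t (.inr (.inl i))
  have hn0 : ∀ t, ∫ ω, feedbackNom S L K R e t ω ∂P = 0 := by
    intro t
    ext i
    rw [eval_integral_piLp fun j => ((hnmem t).eval_piLp j).integrable (by norm_num)]
    exact hs0 t (.inr (.inr i))
  refine ⟨feedbackDist S L K R e, feedbackNom S L K R e, ⟨hwmem, hnmem, fun t => ?_, fun t => ?_,
    ?_⟩, averageCost_eq_of_tendsto (tendsto_integral_outputTraj_feedbackDist hS he hgram)⟩
  · have h := hM.dist_le
    rw [← hgram t, ← gram_mulVec _ (hsmem t)] at h
    simp only [feedbackSignal_eq_sumElim, selDist_mulVec] at h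
    rw [trace_gram_sumElim_mul_difference (fun i => (hwmem t).eval_piLp i)
      fun i => (hnmem t).eval_piLp i] at h
    exact h
  · have hG := (hasGaussianLaw_feedbackNom (S := S) (L := L) (K := K) (R := R) heind heG t)
    have := hG.isGaussian_map
    have hmeas := (hnmem t).1.aemeasurable
    -- Both laws are centered Gaussian, so agreement of second moments suffices.
    refine eq_of_secondMoment_eq ?_ hmean ?_
    · rw [integral_map (f := fun v => v) hmeas (by fun_prop), hn0]
    · have h := hM.nominal
      rw [← hgram t, ← gram_mulVec _ (hsmem t)] at h
      simp only [feedbackSignal_eq_sumElim, selNom_mulVec] at h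
      rw [h, gram_eq_secondMoment hmeas]
  · cases k
    · trivial
    · refine ⟨?_, hw0⟩
      -- Without feedback, `w(t)` is a fixed linear image of `e(t+1)`, so independence is inherited.
      obtain rfl := hK hM.mem_momentSet.1
      have h : feedbackDist S L 0 R e = fun t => (fun v : EuclideanSpace ℝ (X ⊕ (W ⊕ W)) =>
          (WithLp.toLp 2 fun i => (Rᵀ *ᵥ v.ofLp) (.inl i) : EuclideanSpace ℝ W)) ∘ e (t + 1) := by
        ext t ω i
        change feedbackSignal S L 0 R e t ω (.inr (.inl i)) = _
        rw [feedbackSignal, feedbackMap_mulVec]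
        simp
      rw [h]
      exact (heind.precomp (g := fun t => t + 1) (add_left_injective 1)).comp _ fun t => by
        fun_prop

end LowerBound

/-! ### Feasibility and equality of the values -/

/-- The nominal disturbance is feasible. -/
theorem exists_worstCaseFeasible {W : Type} [Fintype W] {Ω : Type*} [MeasurableSpace Ω]
    [MeasurableSpace.CountablySeparated Ω] (P : Measure Ω) [IsProbabilityMeasure P]
    [NullSingletonClass P] (γ : ℝ) (Pnom : Measure (EuclideanSpace ℝ W)) [IsGaussian Pnom]
    (hmean : ∫ v, v ∂Pnom = 0) (k : DisturbanceKind) :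
    ∃ w what : ℕ → Ω → EuclideanSpace ℝ W, WorstCaseFeasible k P γ Pnom w what := by
  obtain ⟨e, hem, helaw, heind⟩ := exists_iIndepFun_map_eq P Pnom
  have heG : ∀ t, HasGaussianLaw (e t) P := fun t => ⟨by rw [helaw]; infer_instance⟩
  have he : ∀ t, MemLp (e t) 2 P := fun t => (heG t).memLp_two
  refine ⟨e, e, he, he, fun t => by simpa using sq_nonneg γ, helaw, ?_⟩
  cases k
  · trivial
  · refine ⟨heind, fun t => ?_⟩
    rw [← integral_map (φ := e t) (f := fun v => v) (hem t).aemeasurable (by fun_prop), helaw, hmean]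

/-- The worst-case problem and its moment relaxation are feasible with equal values, for every
stable linear system. -/
theorem worstCaseValue_eq_momentValue {X W Z : Type} [Fintype X] [DecidableEq X] [Fintype W]
    [DecidableEq W] [Fintype Z] {S : LinSys X W Z} (hS : IsStable S.A) {Ω : Type*}
    [MeasurableSpace Ω] [MeasurableSpace.CountablySeparated Ω] (P : Measure Ω)
    [IsProbabilityMeasure P] [NullSingletonClass P] (γ : ℝ) (Pnom : Measure (EuclideanSpace ℝ W))
    [IsGaussian Pnom] (hmean : ∫ v, v ∂Pnom = 0) (k : DisturbanceKind) :
    worstCaseValue S k P γ Pnom = momentValue S k γ (secondMoment Pnom) := by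
  apply le_antisymm
  · refine sSup_le ?_
    rintro _ ⟨w, what, h, rfl⟩
    refine le_of_forall_lt fun a ha => ?_
    -- A level strictly below the limsup is exceeded at infinitely many horizons.
    obtain ⟨b, hab, hb⟩ := exists_between ha
    obtain ⟨M, hM, hMb⟩ := h.exists_momentFeasible hS
      ((frequently_lt_of_lt_limsup (by isBoundedDefault) hb).mono fun T hT => hT.le)
    exact hab.trans_le (hMb.trans (le_sSup ⟨M, hM, rfl⟩))
  · refine sSup_le ?_
    rintro _ ⟨M, hM, rfl⟩
    obtain ⟨w, what, h, hc⟩ := hM.exists_worstCaseFeasible (P := P) hS hmean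
    exact le_sSup ⟨w, what, h, hc.symm⟩

end DRControl

theorem mainTheorem3 {nx nw nu nz ny : ℕ}
    (G : DRControl.Plant nx nw nu nz ny) (K : DRControl.Controller nx nu ny)
    {Ω : Type*} [MetricSpace Ω] [TopologicalSpace.SeparableSpace Ω] [MeasurableSpace Ω]
    [BorelSpace Ω] (P : Measure Ω) [IsProbabilityMeasure P] [NullSingletonClass P]
    (γ : ℝ) (Pnom : Measure (EuclideanSpace ℝ (Fin nw))) [IsGaussian Pnom]
    (hmean : ∫ v, v ∂Pnom = 0)
    (hstable : DRControl.IsStable (DRControl.closedLoop G K).A)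
    (k : DRControl.DisturbanceKind) :
    (∃ w what : ℕ → Ω → EuclideanSpace ℝ (Fin nw),
      DRControl.WorstCaseFeasible k P γ Pnom w what) ∧
    (∃ M, DRControl.MomentFeasible (DRControl.closedLoop G K) k γ
      (DRControl.secondMoment Pnom) M) ∧
    DRControl.worstCaseValue (DRControl.closedLoop G K) k P γ Pnom =
      DRControl.momentValue (DRControl.closedLoop G K) k γ (DRControl.secondMoment Pnom) := by
  -- Second countability makes the Borel σ-algebra countably separated.
  have := UniformSpace.secondCountable_of_separable Ω
  obtain ⟨w, what, h⟩ := DRControl.exists_worstCaseFeasible P γ Pnom hmean k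
  -- With level `⊥` the cost condition is void, and only feasibility of the limit point remains.
  obtain ⟨M, hM, -⟩ := h.exists_momentFeasible hstable (a := ⊥)
    (Frequently.of_forall fun _ => bot_le)
  exact ⟨⟨w, what, h⟩, ⟨M, hM⟩,
    DRControl.worstCaseValue_eq_momentValue hstable P γ Pnom hmean k⟩
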